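/- **Setting.** Let $1\le k<p$ and $1\le n\le p$, let $n_o\ge 0$, let $\Sigma_x\in\mathbb{R}^{p\times p}$ be positive definite with smallest eigenvalue $\lambda_{\min}(\Sigma_x)$, let $\sigma_x,\sigma_\epsilon\ge 0$, and let $\beta^*\in\mathbb{R}^p$ have at most $k$ nonzero entries. A real random variable $v$ is called sub-Gaussian with parameter $\sigma$ if $\mathbb{E}\,e^{tv}\le e^{t^2\sigma^2/2}$ for all $t\in\mathbb{R}$. *Clean data.* Let $C\subseteq\{1,\dots,n+n_o\}$ with $|C|\ge n$. For $i\in C$ let $(x_i,\epsilon_i)\in\mathbb{R}^p\times\mathbb{R}$ be independent random pairs with $\epsilon_i$ independent of $x_i$, such that $x_i$ has mean zero and covariance $\frac1n\Sigma_x$, $\langle u,x_i\rangle$ is sub-Gaussian with parameter $\sigma_x/\sqrt n$ for every unit vector $u$, and $\epsilon_i$ is sub-Gaussian with parameter $\sigma_\epsilon/\sqrt n$. Put $y_i=\langle x_i,\beta^*\rangle+\epsilon_i$. (The cases of main interest are $C=\{1,\dots,n+n_o\}$ and a fixed set $C$ of exactly $n$ authentic samples.) *Corruption.* An adversary who sees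 everything leaves at least $n$ of the pairs $(x_i,y_i)$, $i\in C$, unaltered, and replaces all other rows by arbitrary values; the result is the observed data $X\in\mathbb{R}^{(n+n_o)\times p}$, $Y\in\mathbb{R}^{n+n_o}$. Thus at most $n_o$ of the $n+n_o$ observed pairs are outliers, in the covariate, in the response or in both. *Estimator.* For $u,v\in\mathbb{R}^{n+n_o}$ let the trimmed inner product $\langle u,v\rangle_{\mathrm{trim}}$ be the sum of the $n$ products $u_iv_i$ of smallest absolute value, i.e. the $n_o$ products of largest absolute value are discarded (ties broken arbitrarily). For $\alpha\in[0,1]$ put $\hat\Gamma_{ab}=\alpha\langle X_a,X_b\rangle_{\mathrm{trim}}+(1-\alpha)I_{ab}$ and $\hat\gamma_a=\langle X_a,Y\rangle_{\mathrm{trim}}$, where $X_a$ is the $a$-th column of $X$. The output of the robust elastic net with parameters $\alpha,R$ is any $$\hat\beta\in\arg\min_{\|\beta\|_1\le R}\Big\{\tfrac12\beta^T\hat\Gamma\beta-\langle\hat\gamma,\beta\rangle\Big\}.$$ **Corollary 1 (robust Lasso, $\alpha=1$).** There are absolute constants $C_1,c_2,C_3>0$ such that in every such setting with $$n\ \ge\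 C_1\,\frac{\sigma_x^4}{\lambda_{\min}^2(\Sigma_x)}\,k\log p,\qquad \frac{n_o}{n}\ \le\ c_2\,\frac{\lambda_{\min}(\Sigma_x)}{\sigma_x^2\,k\log p},$$ there is an event of probability larger than $1-p^{-2}$ on which, for every action of the adversary and every output $\hat\beta$ of the robust elastic net with $\alpha=1$ and $R=\|\beta^*\|_1$, $$\frac1{2\sqrt k}\|\hat\beta-\beta^*\|_1\le\|\hat\beta-\beta^*\|_2\le C_3\,\frac{32}{\lambda_{\min}(\Sigma_x)}\bigg(\frac{k\,n_o\log p}{n}\sigma_x^2\|\beta^*\|_2+\sqrt{\frac{k\,\sigma_x^2\sigma_\epsilon^2\log p}{n}}+\frac{n_o\log p\,\sqrt k\,\sigma_x}{n}\sqrt{\sigma_\epsilon^2+\sigma_x^2\|\beta^*\|_2^2}\bigg).$$ No sparsity condition on $\Sigma_x$ is assumed. -/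

import Mathlib

open MeasureTheory ProbabilityTheory Finset
open scoped NNReal Matrix

/-- The `ℓ₁` norm of a vector of `ℝᵖ`. -/
def l1Norm {p : ℕ} (v : EuclideanSpace ℝ (Fin p)) : ℝ := ∑ j, |v j|

/-- `v` has at most `k` nonzero coordinates. -/
def IsSparse {p : ℕ} (k : ℕ) (v : EuclideanSpace ℝ (Fin p)) : Prop :=
  {j | v j ≠ 0}.ncard ≤ k

/-- The smallest eigenvalue of a real symmetric matrix (of size at least one). -/
noncomputable def lambdaMin {p : ℕ} {S : Matrix (Fin p) (Fin p) ℝ} (hS : S.IsHermitian) : ℝ :=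
  ⨅ j, hS.eigenvalues j

/-- Sub-Gaussian linear model for the samples with index in `C`, before any corruption.
The rows `xᵢ` are centred with covariance `Σ / n` and every one-dimensional marginal is
sub-Gaussian with variance proxy `σₓ² / n`; the noise `εᵢ` is sub-Gaussian with variance proxy
`σ_ε² / n` and independent of `xᵢ`; the pairs `(xᵢ, εᵢ)` are independent; the responses obey
`yᵢ = ⟨xᵢ, β⟩ + εᵢ`. -/
structure SubGaussianLinearModel {Ω ι : Type*} [MeasurableSpace Ω] (μ : Measure Ω) {p : ℕ}
    (n : ℕ) (C : Finset ι) (S : Matrix (Fin p) (Fin p) ℝ) (σx σε : ℝ≥0)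
    (β : EuclideanSpace ℝ (Fin p)) (x : ι → Ω → EuclideanSpace ℝ (Fin p))
    (ε y : ι → Ω → ℝ) : Prop where
  measurable_x : ∀ i ∈ C, Measurable (x i)
  measurable_noise : ∀ i ∈ C, Measurable (ε i)
  mean_zero : ∀ i ∈ C, ∀ a, ∫ ω, x i ω a ∂μ = 0
  covariance_eq : ∀ i ∈ C, ∀ a b, cov[fun ω => x i ω a, fun ω => x i ω b; μ] = S a b / n
  subGaussian_x : ∀ i ∈ C, ∀ u : EuclideanSpace ℝ (Fin p), ‖u‖ = 1 →
    HasSubgaussianMGF (fun ω => inner ℝ u (x i ω)) (σx ^ 2 / n) μ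
  subGaussian_noise : ∀ i ∈ C, HasSubgaussianMGF (ε i) (σε ^ 2 / n) μ
  indep_noise : ∀ i ∈ C, IndepFun (x i) (ε i) μ
  indep_samples : iIndepFun (fun (i : C) (ω : Ω) => (x i ω, ε i ω)) μ
  linear_model : ∀ i ∈ C, ∀ ω, y i ω = inner ℝ (x i ω) β + ε i ω

/-- The observed data `(X, Y)` contain at least `n` of the clean pairs `(xᵢ, yᵢ)`, `i ∈ C`,
unaltered; everything else in `(X, Y)` is arbitrary. With `n + nO` observations this means that
at most `nO` pairs are corrupted, in the covariate, in the response, or in both. -/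
def IsCorruption {ι : Type*} {p : ℕ} (n : ℕ) (C : Finset ι)
    (x : ι → EuclideanSpace ℝ (Fin p)) (y : ι → ℝ)
    (X : Matrix ι (Fin p) ℝ) (Y : ι → ℝ) : Prop :=
  ∃ A ⊆ C, n ≤ #A ∧ ∀ i ∈ A, (∀ j, X i j = x i j) ∧ Y i = y i

/-- `t` is a trimmed inner product of `u` and `v` with `m` retained terms: the sum of `m`
products `uᵢ vᵢ` of smallest magnitude. Ties may be broken in any way. -/
def IsTrimmedInner {ι : Type*} (m : ℕ) (u v : ι → ℝ) (t : ℝ) : Prop :=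
  ∃ I : Finset ι, #I = m ∧ (∀ i ∈ I, ∀ j ∉ I, |u i * v i| ≤ |u j * v j|) ∧
    t = ∑ i ∈ I, u i * v i

/-- The robust surrogates of the robust elastic net:
`Γ = α ⟨X_a, X_b⟩_trim + (1 - α) I` and `γ = ⟨X_a, Y⟩_trim`, with `m` terms retained. -/
def IsRENSurrogate {ι : Type*} {p : ℕ} (α : ℝ) (m : ℕ) (X : Matrix ι (Fin p) ℝ) (Y : ι → ℝ)
    (Γ : Matrix (Fin p) (Fin p) ℝ) (γ : Fin p → ℝ) : Prop :=
  (∀ a b, ∃ t, IsTrimmedInner m (fun i => X i a) (fun i => X i b) t ∧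
    Γ a b = α * t + (1 - α) * (1 : Matrix (Fin p) (Fin p) ℝ) a b) ∧
  ∀ a, IsTrimmedInner m (fun i => X i a) Y (γ a)

/-- The objective `½ βᵀ Γ β - ⟨γ, β⟩`. -/
noncomputable def quadObjective {p : ℕ} (Γ : Matrix (Fin p) (Fin p) ℝ) (γ : Fin p → ℝ)
    (β : EuclideanSpace ℝ (Fin p)) : ℝ :=
  (1 / 2) * ((β : Fin p → ℝ) ⬝ᵥ (Γ *ᵥ (β : Fin p → ℝ))) - γ ⬝ᵥ (β : Fin p → ℝ)

/-- `b` is an output of the robust elastic net with parameter `α` and radius `R`: a global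
minimizer of the objective built from the robust surrogates over the `ℓ₁` ball of radius `R`. -/
def IsRENOutput {ι : Type*} {p : ℕ} (α R : ℝ) (m : ℕ) (X : Matrix ι (Fin p) ℝ) (Y : ι → ℝ)
    (b : EuclideanSpace ℝ (Fin p)) : Prop :=
  ∃ Γ γ, IsRENSurrogate α m X Y Γ γ ∧ l1Norm b ≤ R ∧
    ∀ β : EuclideanSpace ℝ (Fin p), l1Norm β ≤ R → quadObjective Γ γ b ≤ quadObjective Γ γ β

/-! Up to logarithms, every clean product `x i a * x i b` or `x i a * y i` has size of order 1/n.
Trimming keeps n products, so outliers that survive displace clean products at least as large in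
absolute value. Hence each entry of the surrogates differs from the corresponding sum over n
uncorrupted rows by at most 2 nO times the largest clean product (`IsTrimmedInner.abs_sub_sum_le`),
whatever the adversary does.

Comparing the objective at the minimiser b with its value at the feasible point β gives a basic
inequality for v = b - β (`IsRENOutput.error_bound`). The ℓ₁ constraint puts v in the cone ‖v‖₁ ≤
2√k ‖v‖₂. Entrywise errors therefore cost only a factor k in the quadratic term and √k in the linear
one. The outlier bound makes the quadratic loss a fraction of the smallest eigenvalue.

The curvature comes from a restricted eigenvalue bound for the clean Gram matrix. Bernstein's
inequality and a union bound control it on the finitely many sums of 2k signed coordinate vectors,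
and Maurey's empirical method (`Matrix.le_dotProduct_mulVec_of_signedSum`) extends the lower bound
to the cone without a covering net.

All random estimates concern the full clean set C. Passing to the adversary's subset is
deterministic, because at most nO bounded terms are lost, so one event serves all corruptions. -/

section SubGaussianSquares

/-! ### Exponential moments and Bernstein bounds for squares of sub-Gaussian variables. -/

variable {Ω : Type*} [MeasurableSpace Ω] {μ : Measure Ω} [IsProbabilityMeasure μ]

lemma lintegral_exp_sq_div_four_gaussianReal_le :
    ∫⁻ g, ENNReal.ofReal (Real.exp (g ^ 2 / 4)) ∂(gaussianReal 0 1) ≤ 2 := by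
  rw [gaussianReal_of_var_ne_zero 0 one_ne_zero,
    lintegral_withDensity_eq_lintegral_mul _ (measurable_gaussianPDF 0 1) (by fun_prop)]
  have key : ∀ g : ℝ, (gaussianPDF 0 1 * fun g => ENNReal.ofReal (Real.exp (g ^ 2 / 4))) g
      ≤ 2 * gaussianPDF 0 2 g := by
    intro g
    simp only [Pi.mul_apply, gaussianPDF]
    rw [← ENNReal.ofReal_mul (gaussianPDFReal_nonneg _ _ _),
      show (2 : ENNReal) = ENNReal.ofReal 2 by simp, ← ENNReal.ofReal_mul (by norm_num)]
    apply ENNReal.ofReal_le_ofReal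
    simp only [gaussianPDFReal, NNReal.coe_one, NNReal.coe_ofNat, sub_zero]
    rw [mul_assoc, ← Real.exp_add, ← mul_assoc]
    have h1 : -g ^ 2 / (2 * 1) + g ^ 2 / 4 = -g ^ 2 / (2 * 2) := by ring
    rw [h1]
    apply mul_le_mul_of_nonneg_right _ (Real.exp_nonneg _)
    rw [← div_eq_mul_inv, inv_eq_one_div, div_le_div_iff₀ (by positivity) (by positivity)]
    rw [one_mul, show (2 : ℝ) = √4 by rw [show (4 : ℝ) = 2 ^ 2 by norm_num]; simp,
      ← Real.sqrt_mul (by norm_num)]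
    apply Real.sqrt_le_sqrt
    rw [show √4 = (2 : ℝ) by rw [show (4 : ℝ) = 2 ^ 2 by norm_num]; simp]
    nlinarith [Real.pi_pos]
  calc _ ≤ ∫⁻ g, 2 * gaussianPDF 0 2 g := lintegral_mono key
    _ = 2 := by
      rw [lintegral_const_mul _ (measurable_gaussianPDF 0 2),
        lintegral_gaussianPDF_eq_one 0 two_ne_zero, mul_one]

/-- Gaussian linearisation: exp(t²/2) is the mean of exp(g t) for a standard normal g. With t =
Z/√(2c) the square becomes linear in Z. After exchanging the integrals, the sub-Gaussian bound
leaves the mean of exp(g²/4), which is at most 2. -/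
lemma ProbabilityTheory.HasSubgaussianMGF.lintegral_exp_sq_le {Z : Ω → ℝ} {c : ℝ≥0}
    (h : HasSubgaussianMGF Z c μ) (hc : c ≠ 0) :
    ∫⁻ ω, ENNReal.ofReal (Real.exp (Z ω ^ 2 / (4 * c))) ∂μ ≤ 2 := by
  have hc' : (0 : ℝ) < c := by positivity
  set r : ℝ := √(2 * c) with hr
  have hr2 : r ^ 2 = 2 * c := Real.sq_sqrt (by positivity)
  have hr0 : 0 < r := by positivity
  have h1 : ∀ ω, ENNReal.ofReal (Real.exp (Z ω ^ 2 / (4 * c)))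
      = ∫⁻ g, ENNReal.ofReal (Real.exp ((g / r) * Z ω)) ∂(gaussianReal 0 1) := by
    intro ω
    have h2 := congrFun (mgf_id_gaussianReal (μ := 0) (v := 1)) (Z ω / r)
    have h3 : Integrable (fun g : ℝ => Real.exp (Z ω / r * g)) (gaussianReal 0 1) :=
      integrable_exp_mul_gaussianReal _
    rw [mgf] at h2
    simp only [id, zero_mul, zero_add, NNReal.coe_one, one_mul, div_pow, hr2] at h2
    rw [show Z ω ^ 2 / (4 * c) = Z ω ^ 2 / (2 * c) / 2 by field_simp; norm_num, ← h2,
      ofReal_integral_eq_lintegral_ofReal h3 (ae_of_all _ fun _ => (Real.exp_nonneg _))]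
    refine lintegral_congr fun g => ?_
    congr 2; ring
  simp_rw [h1]
  rw [lintegral_lintegral_swap]
  · refine le_trans (lintegral_mono fun g => ?_) lintegral_exp_sq_div_four_gaussianReal_le
    rw [← ofReal_integral_eq_lintegral_ofReal (h.integrable_exp_mul _)
      (ae_of_all _ fun _ => (Real.exp_nonneg _))]
    apply ENNReal.ofReal_le_ofReal
    refine (h.mgf_le (g / r)).trans (le_of_eq ?_)
    congr 1
    rw [div_pow, hr2]; field_simp; norm_num
  · have := h.aemeasurable.comp_fst (ν := gaussianReal 0 1)
    apply AEMeasurable.ennreal_ofReal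
    apply Real.measurable_exp.comp_aemeasurable
    exact AEMeasurable.mul (by fun_prop) this

lemma ProbabilityTheory.HasSubgaussianMGF.integrable_exp_sq {Z : Ω → ℝ} {c : ℝ≥0}
    (h : HasSubgaussianMGF Z c μ) (hc : c ≠ 0) :
    Integrable (fun ω => Real.exp (Z ω ^ 2 / (4 * c))) μ := by
  refine ⟨(Real.measurable_exp.comp_aemeasurable
    ((h.aemeasurable.pow_const 2).div_const _)).aestronglyMeasurable, ?_⟩
  rw [hasFiniteIntegral_iff_ofReal (ae_of_all _ fun _ => (Real.exp_nonneg _))]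
  exact (h.lintegral_exp_sq_le hc).trans_lt (by simp)

lemma ProbabilityTheory.HasSubgaussianMGF.integral_exp_sq_le {Z : Ω → ℝ} {c : ℝ≥0}
    (h : HasSubgaussianMGF Z c μ) (hc : c ≠ 0) :
    ∫ ω, Real.exp (Z ω ^ 2 / (4 * c)) ∂μ ≤ 2 := by
  rw [integral_eq_lintegral_of_nonneg_ae (ae_of_all _ fun _ => (Real.exp_nonneg _))
    (h.integrable_exp_sq hc).aestronglyMeasurable]
  exact ENNReal.toReal_le_of_le_ofReal (by norm_num) (by simpa using h.lintegral_exp_sq_le hc)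

/-- The second moment is at most four times the variance proxy. -/
lemma ProbabilityTheory.HasSubgaussianMGF.integral_sq_le {Z : Ω → ℝ} {c : ℝ≥0}
    (h : HasSubgaussianMGF Z c μ) : ∫ ω, Z ω ^ 2 ∂μ ≤ 4 * c := by
  rcases eq_or_ne c 0 with rfl | hc
  · have := h.ae_eq_zero_of_hasSubgaussianMGF_zero
    rw [integral_congr_ae (g := fun _ => 0) (by filter_upwards [this] with ω hω; simp [hω])]
    simp
  have hc' : (0 : ℝ) < c := by positivity
  have h1 : ∫ ω, (Z ω ^ 2 / (4 * c) + 1) ∂μ ≤ 2 :=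
    (integral_mono (((h.memLp 2).integrable_sq.div_const _).add (integrable_const _))
      (h.integrable_exp_sq hc) fun ω => Real.add_one_le_exp _).trans (h.integral_exp_sq_le hc)
  rw [integral_add ((h.memLp 2).integrable_sq.div_const _) (integrable_const _), integral_div] at h1
  simp only [integral_const, probReal_univ, smul_eq_mul, mul_one] at h1
  have h2 : (∫ ω, Z ω ^ 2 ∂μ) / (4 * c) ≤ 1 := by linarith
  rwa [div_le_one (by positivity)] at h2

/-- Second-order Taylor bound; keeping the linear term exact lets it cancel against the mean when
the square is centred. -/
lemma Real.exp_le_one_add_add_sq_mul_exp_abs (x : ℝ) :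
    Real.exp x ≤ 1 + x + x ^ 2 * Real.exp |x| := by
  have h := Complex.norm_exp_sub_sum_le_norm_mul_exp (x : ℂ) 2
  have e : Complex.exp x - ∑ m ∈ Finset.range 2, (x : ℂ) ^ m / (m.factorial : ℂ)
      = ((Real.exp x - (1 + x) : ℝ) : ℂ) := by
    simp [Finset.sum_range_succ]
  rw [e, Complex.norm_real, Complex.norm_real, Real.norm_eq_abs, Real.norm_eq_abs, sq_abs] at h
  linarith [le_abs_self (Real.exp x - (1 + x))]

lemma ProbabilityTheory.HasSubgaussianMGF.integrable_exp_mul_sq {Z : Ω → ℝ} {c : ℝ≥0}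
    (h : HasSubgaussianMGF Z c μ) (hc : c ≠ 0) {s : ℝ} (hs : |s| ≤ 1 / (8 * c)) :
    Integrable (fun ω => Real.exp (s * Z ω ^ 2)) μ := by
  have hc' : (0 : ℝ) < c := by positivity
  refine (h.integrable_exp_sq hc).mono' (Real.measurable_exp.comp_aemeasurable
    ((h.aemeasurable.pow_const 2).const_mul _)).aestronglyMeasurable (ae_of_all _ fun ω => ?_)
  rw [Real.norm_of_nonneg (Real.exp_nonneg _)]
  apply Real.exp_le_exp.2
  have : s ≤ 1 / (4 * c) := (le_abs_self s).trans (hs.trans (by gcongr; norm_num))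
  calc s * Z ω ^ 2 ≤ 1 / (4 * c) * Z ω ^ 2 := by gcongr
    _ = _ := by ring

/-- The centred square of a sub-Gaussian variable is sub-exponential. -/
lemma ProbabilityTheory.HasSubgaussianMGF.mgf_sq_sub_le {Z : Ω → ℝ} {c : ℝ≥0}
    (h : HasSubgaussianMGF Z c μ) (hc : c ≠ 0) {s : ℝ} (hs : |s| ≤ 1 / (8 * c)) :
    mgf (fun ω => Z ω ^ 2 - ∫ ω', Z ω' ^ 2 ∂μ) μ s ≤ Real.exp (256 * c ^ 2 * s ^ 2) := by
  have hc' : (0 : ℝ) < c := by positivity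
  set m := ∫ ω', Z ω' ^ 2 ∂μ with hm
  have h0 : ∀ ω, Real.exp (s * Z ω ^ 2)
      ≤ 1 + s * Z ω ^ 2 + 128 * c ^ 2 * s ^ 2 * Real.exp (Z ω ^ 2 / (4 * c)) := by
    intro ω
    refine (Real.exp_le_one_add_add_sq_mul_exp_abs _).trans ?_
    set q := Z ω ^ 2 with hq
    have hq0 : 0 ≤ q := by positivity
    -- The integrable weight exp(q/(4c)) is split into two equal factors: one absorbs the quadratic
    -- factor q², the other absorbs exp|s q|.
    have h1 : (q / (8 * c)) ^ 2 / 2 ≤ Real.exp (q / (8 * c)) := by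
      have := Real.quadratic_le_exp_of_nonneg (show 0 ≤ q / (8 * c) by positivity)
      have : 0 ≤ q / (8 * c) := by positivity
      linarith
    have h2 : Real.exp |s * q| ≤ Real.exp (q / (8 * c)) := by
      apply Real.exp_le_exp.2
      rw [abs_mul, abs_of_nonneg hq0]
      calc |s| * q ≤ 1 / (8 * c) * q := by gcongr
        _ = _ := by ring
    have h3 : (s * q) ^ 2 * Real.exp |s * q|
        ≤ 128 * c ^ 2 * s ^ 2 * (Real.exp (q / (8 * c)) * Real.exp (q / (8 * c))) := by
      calc (s * q) ^ 2 * Real.exp |s * q|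
          = 128 * c ^ 2 * s ^ 2 * ((q / (8 * c)) ^ 2 / 2 * Real.exp |s * q|) := by field_simp; ring
        _ ≤ _ := by gcongr
    rw [← Real.exp_add, show q / (8 * c) + q / (8 * c) = q / (4 * (c : ℝ)) by field_simp; ring] at h3
    linarith
  have hi1 : Integrable (fun ω => 1 + s * Z ω ^ 2) μ :=
    (integrable_const _).add ((h.memLp 2).integrable_sq.const_mul _)
  have h1 : ∫ ω, Real.exp (s * Z ω ^ 2) ∂μ ≤ 1 + s * m + 128 * c ^ 2 * s ^ 2 * 2 := by
    refine (integral_mono (h.integrable_exp_mul_sq hc hs)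
      (hi1.add ((h.integrable_exp_sq hc).const_mul _)) h0).trans ?_
    simp only [Pi.add_apply]
    rw [integral_add hi1 ((h.integrable_exp_sq hc).const_mul _),
      integral_add (integrable_const _) ((h.memLp 2).integrable_sq.const_mul _), integral_const_mul,
      integral_const_mul]
    have := h.integral_exp_sq_le hc
    simp only [integral_const, probReal_univ, smul_eq_mul, mul_one]
    gcongr
  rw [mgf]
  have h2 : ∀ ω, Real.exp (s * (Z ω ^ 2 - m)) = Real.exp (-(s * m)) * Real.exp (s * Z ω ^ 2) := by
    intro ω; rw [← Real.exp_add]; ring_nf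
  simp_rw [h2]
  rw [integral_const_mul]
  calc _ ≤ Real.exp (-(s * m)) * Real.exp (s * m + 256 * c ^ 2 * s ^ 2) := by
        gcongr
        refine h1.trans (le_trans (le_of_eq ?_) (Real.add_one_le_exp _))
        ring
    _ = _ := by rw [← Real.exp_add]; ring_nf

lemma ProbabilityTheory.HasSubgaussianMGF.integrable_exp_mul_sq_sub {Z : Ω → ℝ} {c : ℝ≥0}
    (h : HasSubgaussianMGF Z c μ) (hc : c ≠ 0) {s : ℝ} (hs : |s| ≤ 1 / (8 * c)) (m : ℝ) :
    Integrable (fun ω => Real.exp (s * (Z ω ^ 2 - m))) μ := by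
  have h2 : ∀ ω, Real.exp (s * (Z ω ^ 2 - m)) = Real.exp (-(s * m)) * Real.exp (s * Z ω ^ 2) := by
    intro ω; rw [← Real.exp_add]; ring_nf
  simp_rw [h2]
  exact (h.integrable_exp_mul_sq hc hs).const_mul _

/-- Bernstein's inequality for sums of squares of independent sub-Gaussian variables. -/
lemma measureReal_abs_sum_sq_sub_gt_le {ι : Type*} [Fintype ι] {Z : ι → Ω → ℝ} {c : ℝ≥0}
    (hc : c ≠ 0) (hind : iIndepFun Z μ) (h : ∀ i, HasSubgaussianMGF (Z i) c μ) {s t : ℝ}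
    (hs0 : 0 ≤ s) (hs : s ≤ 1 / (8 * c)) :
    μ.real {ω | t < |∑ i, (Z i ω ^ 2 - ∫ ω', Z i ω' ^ 2 ∂μ)|}
      ≤ 2 * Real.exp (-(s * t) + Fintype.card ι * (256 * c ^ 2 * s ^ 2)) := by
  set W : ι → Ω → ℝ := fun i ω => Z i ω ^ 2 - ∫ ω', Z i ω' ^ 2 ∂μ with hW
  have hWm : ∀ i, AEMeasurable (W i) μ := fun i =>
    ((h i).aemeasurable.pow_const 2).sub_const _
  have hWind : iIndepFun W μ :=
    hind.comp (fun i z => z ^ 2 - ∫ ω', Z i ω' ^ 2 ∂μ) (fun i => by fun_prop)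
  have hmgf : ∀ r : ℝ, |r| ≤ 1 / (8 * c) →
      mgf (∑ i, W i) μ r ≤ Real.exp (Fintype.card ι * (256 * c ^ 2 * r ^ 2)) := by
    intro r hr
    rw [hWind.mgf_sum₀ hWm, ← nsmul_eq_mul, Real.exp_nsmul, ← Finset.card_univ]
    rw [← Finset.prod_const]
    exact Finset.prod_le_prod (fun i _ => mgf_nonneg) fun i _ => (h i).mgf_sq_sub_le hc hr
  have hint : ∀ r : ℝ, |r| ≤ 1 / (8 * c) →
      Integrable (fun ω => Real.exp (r * (∑ i, W i) ω)) μ := by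
    intro r hr
    rw [← mgf_pos_iff, hWind.mgf_sum₀ hWm]
    exact Finset.prod_pos fun i _ => mgf_pos ((h i).integrable_exp_mul_sq_sub hc hr _)
  have hsub : {ω | t < |∑ i, (Z i ω ^ 2 - ∫ ω', Z i ω' ^ 2 ∂μ)|}
      ⊆ {ω | t ≤ (∑ i, W i) ω} ∪ {ω | (∑ i, W i) ω ≤ -t} := by
    intro ω hω
    simp only [Set.mem_ofPred_eq, lt_abs, Set.mem_union, Finset.sum_apply, hW] at hω ⊢
    rcases hω with hω | hω
    · exact Or.inl hω.le
    · right; linarith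
  have hs1 : |s| ≤ 1 / (8 * c) := by rwa [abs_of_nonneg hs0]
  have hs2 : |-s| ≤ 1 / (8 * c) := by rwa [abs_neg]
  have e1 : μ.real {ω | t ≤ (∑ i, W i) ω}
      ≤ Real.exp (-(s * t) + Fintype.card ι * (256 * c ^ 2 * s ^ 2)) := by
    refine (measure_ge_le_exp_mul_mgf t hs0 (hint s hs1)).trans ?_
    rw [Real.exp_add, neg_mul]
    gcongr
    exact hmgf s hs1
  have e2 : μ.real {ω | (∑ i, W i) ω ≤ -t}
      ≤ Real.exp (-(s * t) + Fintype.card ι * (256 * c ^ 2 * s ^ 2)) := by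
    refine (measure_le_le_exp_mul_mgf (-t) (neg_nonpos.2 hs0) (hint (-s) hs2)).trans ?_
    rw [Real.exp_add, show -(-s) * -t = -(s * t) by ring]
    gcongr
    simpa using hmgf (-s) hs2
  calc _ ≤ μ.real ({ω | t ≤ (∑ i, W i) ω} ∪ {ω | (∑ i, W i) ω ≤ -t}) := measureReal_mono hsub
    _ ≤ _ := measureReal_union_le _ _
    _ ≤ _ := by linarith

/-- Tail bound with the threshold written as a multiple of the variance proxy. -/
lemma ProbabilityTheory.HasSubgaussianMGF.measureReal_sq_gt_le {Z : Ω → ℝ} {c : ℝ≥0}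
    (h : HasSubgaussianMGF Z c μ) {r : ℝ} (hr : 0 ≤ r) :
    μ.real {ω | 2 * c * r < Z ω ^ 2} ≤ 2 * Real.exp (-r) := by
  rcases eq_or_ne c 0 with rfl | hc
  · have h1 := h.ae_eq_zero_of_hasSubgaussianMGF_zero
    have h2 : μ {ω | 2 * ((0 : ℝ≥0) : ℝ) * r < Z ω ^ 2} = 0 := by
      rw [measure_eq_zero_iff_ae_notMem]
      filter_upwards [h1] with ω hω
      simp [hω]
    rw [measureReal_def, h2]
    simp only [ENNReal.toReal_zero]
    positivity
  have hc' : (0 : ℝ) < c := by positivity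
  have hb0 : 0 ≤ √(2 * c * r) := Real.sqrt_nonneg _
  have hb : √(2 * c * r) ^ 2 = 2 * c * r := Real.sq_sqrt (by positivity)
  have hsub : {ω | 2 * c * r < Z ω ^ 2}
      ⊆ {ω | √(2 * c * r) ≤ Z ω} ∪ {ω | √(2 * c * r) ≤ (-Z) ω} := by
    intro ω hω
    simp only [Set.mem_ofPred_eq] at hω
    have : √(2 * c * r) ≤ |Z ω| := by
      rw [← Real.sqrt_sq_eq_abs]; exact Real.sqrt_le_sqrt hω.le
    rcases le_abs.1 this with h | h
    · exact Or.inl h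
    · exact Or.inr h
  have e : -√(2 * c * r) ^ 2 / (2 * c) = -r := by rw [hb]; field_simp
  have e1 := h.measure_ge_le hb0
  have e2 := h.neg.measure_ge_le hb0
  rw [e] at e1 e2
  calc _ ≤ _ := measureReal_mono hsub
    _ ≤ _ := measureReal_union_le _ _
    _ ≤ _ := by linarith

end SubGaussianSquares

/-! ### Effect of trimming and of lost samples on sums. -/

section Trimming

variable {ι : Type*} [Fintype ι]

/-- A trimmed inner product is close to the sum over any set of the retained size. -/
lemma IsTrimmedInner.abs_sub_sum_le {u v : ι → ℝ} {t B : ℝ} {n nO : ℕ} {A : Finset ι}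
    (ht : IsTrimmedInner n u v t) (hcard : Fintype.card ι ≤ n + nO) (hA : #A = n)
    (hB0 : 0 ≤ B) (hB : ∀ i ∈ A, |u i * v i| ≤ B) :
    |t - ∑ i ∈ A, u i * v i| ≤ 2 * nO * B := by
  classical
  obtain ⟨I, hI, hmin, rfl⟩ := ht
  have hcardIA : #(I \ A) ≤ nO := by
    have h1 : #(I \ A) + #A ≤ Fintype.card ι := by
      rw [← card_union_of_disjoint sdiff_disjoint]; exact card_le_univ _
    omega
  have hcardeq : #(A \ I) = #(I \ A) := by
    have h1 := card_sdiff_add_card_inter A I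
    have h2 := card_sdiff_add_card_inter I A
    rw [inter_comm] at h2
    omega
  have hI' : ∀ i ∈ I \ A, |u i * v i| ≤ B := by
    intro i hi
    -- `I` and `A` have equal size, so each retained index outside `A` can be compared with a
    -- discarded index of `A`, whose product is no smaller and is bounded by `B`.
    have hne : (A \ I).Nonempty := by
      rw [← card_pos, hcardeq]; exact card_pos.2 ⟨i, hi⟩
    obtain ⟨j, hj⟩ := hne
    rw [mem_sdiff] at hi hj
    exact (hmin i hi.1 j hj.2).trans (hB j hj.1)
  have bound : ∀ s : Finset ι, #s ≤ nO → (∀ i ∈ s, |u i * v i| ≤ B) →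
      |∑ i ∈ s, u i * v i| ≤ nO * B := by
    intro s hs h
    calc |∑ i ∈ s, u i * v i| ≤ ∑ i ∈ s, |u i * v i| := abs_sum_le_sum_abs _ _
      _ ≤ #s • B := sum_le_card_nsmul _ _ _ h
      _ ≤ nO * B := by rw [nsmul_eq_mul]; gcongr
  rw [← sum_sdiff_sub_sum_sdiff]
  have h1 := bound _ hcardIA hI'
  have h2 := bound _ (hcardeq.le.trans hcardIA) fun i hi => hB i (mem_sdiff.1 hi).1
  rw [abs_le] at h1 h2 ⊢
  constructor <;> linarith [h1.1, h1.2, h2.1, h2.2]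

lemma abs_sum_sub_sum_subset_le {f : ι → ℝ} {B : ℝ} {n nO : ℕ} {A C : Finset ι}
    (hcard : Fintype.card ι ≤ n + nO) (hA : #A = n) (hAC : A ⊆ C)
    (hB0 : 0 ≤ B) (hB : ∀ i ∈ C, |f i| ≤ B) :
    |∑ i ∈ C, f i - ∑ i ∈ A, f i| ≤ nO * B := by
  classical
  rw [← sum_sdiff hAC, add_sub_cancel_right]
  have h1 : #(C \ A) ≤ nO := by
    have := card_le_univ C
    rw [card_sdiff_of_subset hAC]; omega
  calc |∑ i ∈ C \ A, f i| ≤ ∑ i ∈ C \ A, |f i| := abs_sum_le_sum_abs _ _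
    _ ≤ #(C \ A) • B := sum_le_card_nsmul _ _ _ fun i hi => hB i (mem_sdiff.1 hi).1
    _ ≤ nO * B := by rw [nsmul_eq_mul]; gcongr

end Trimming

/-! ### Sparsity and the ℓ₁ cone. -/

section Cone

variable {p k : ℕ}

lemma l1Norm_nonneg (v : EuclideanSpace ℝ (Fin p)) : 0 ≤ l1Norm v :=
  sum_nonneg fun _ _ => abs_nonneg _

lemma sum_abs_le_sqrt_mul_norm {T : Finset (Fin p)} (hT : #T ≤ k)
    (v : EuclideanSpace ℝ (Fin p)) : ∑ j ∈ T, |v j| ≤ √(k : ℝ) * ‖v‖ := by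
  rw [EuclideanSpace.norm_eq, ← Real.sqrt_mul (by positivity)]
  apply Real.le_sqrt_of_sq_le
  calc (∑ j ∈ T, |v j|) ^ 2 ≤ #T * ∑ j ∈ T, |v j| ^ 2 := sq_sum_le_card_mul_sum_sq
    _ ≤ k * ∑ j, ‖v j‖ ^ 2 := by
      have h : ∑ j ∈ T, |v j| ^ 2 ≤ ∑ j, ‖v j‖ ^ 2 :=
        sum_le_sum_of_subset_of_nonneg (subset_univ _) fun _ _ _ => by positivity
      gcongr

lemma IsSparse.exists_finset {β : EuclideanSpace ℝ (Fin p)} (h : IsSparse k β) :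
    ∃ T : Finset (Fin p), #T ≤ k ∧ ∀ j ∉ T, β j = 0 := by
  classical
  refine ⟨univ.filter fun j => β j ≠ 0, ?_, fun j hj => by simpa using hj⟩
  rw [IsSparse, Set.ncard_eq_toFinset_card'] at h
  simpa using h

lemma IsSparse.l1Norm_le {β : EuclideanSpace ℝ (Fin p)} (h : IsSparse k β) :
    l1Norm β ≤ √(k : ℝ) * ‖β‖ := by
  obtain ⟨T, hT, h0⟩ := h.exists_finset
  rw [l1Norm, ← sum_subset (subset_univ T) fun j _ hj => by simp [h0 j hj]]
  exact sum_abs_le_sqrt_mul_norm hT β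

/-- The error of an `ℓ₁`-constrained estimator of a sparse vector lies in a cone. -/
lemma IsSparse.l1Norm_sub_le {b β : EuclideanSpace ℝ (Fin p)} (h : IsSparse k β)
    (hb : l1Norm b ≤ l1Norm β) : l1Norm (b - β) ≤ 2 * √(k : ℝ) * ‖b - β‖ := by
  obtain ⟨T, hT, h0⟩ := h.exists_finset
  have h1 := sum_abs_le_sqrt_mul_norm hT (b - β)
  have e : ∀ f : Fin p → ℝ, ∑ j, f j = ∑ j ∈ T, f j + ∑ j ∈ Tᶜ, f j := fun f =>
    (sum_add_sum_compl T f).symm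
  simp only [l1Norm] at hb ⊢
  rw [e, e (fun j => |β j|)] at hb
  rw [e]
  have h2 : ∑ j ∈ Tᶜ, |(b - β) j| = ∑ j ∈ Tᶜ, |b j| :=
    sum_congr rfl fun j hj => by simp [h0 j (mem_compl.1 hj)]
  have h3 : ∑ j ∈ Tᶜ, |β j| = 0 :=
    sum_eq_zero fun j hj => by simp [h0 j (mem_compl.1 hj)]
  have h4 : ∑ j ∈ T, |β j| ≤ ∑ j ∈ T, |b j| + ∑ j ∈ T, |(b - β) j| := by
    rw [← sum_add_distrib]
    refine sum_le_sum fun j _ => ?_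
    have := abs_sub_abs_le_abs_sub (β j) (b j)
    rw [abs_sub_comm] at this
    simp only [PiLp.sub_apply]
    linarith
  linarith

end Cone

/-! ### Maurey's empirical method for quadratic forms. -/

section EmpiricalMethod

/-- Maurey's empirical method, in derandomised form: a quadratic form that is nonnegative on all
sums of `m` atoms is almost nonnegative on `m` times a convex combination of the atoms. -/
lemma LinearMap.BilinForm.nonneg_of_nonneg_on_sums {E κ : Type*} [AddCommGroup E] [Module ℝ E]
    [Fintype κ] (B : LinearMap.BilinForm ℝ E) (e : κ → E) (θ : κ → ℝ) (hθ : ∀ j, 0 ≤ θ j)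
    (hθ1 : ∑ j, θ j = 1) (m : ℕ) (u : E)
    (h : ∀ f : Fin m → κ, 0 ≤ B (u + ∑ l, e (f l)) (u + ∑ l, e (f l))) :
    0 ≤ B (u + (m : ℝ) • ∑ j, θ j • e j) (u + (m : ℝ) • ∑ j, θ j • e j)
      + m * (∑ j, θ j * B (e j) (e j) - B (∑ j, θ j • e j) (∑ j, θ j • e j)) := by
  -- The conclusion is the expectation of the form at u plus m independent atoms of law θ: its value
  -- at the mean plus m times the variance term. The induction averages over one atom at a time.
  induction m generalizing u with
  | zero => simpa using h Fin.elim0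
  | succ m ih =>
    set v := ∑ j, θ j • e j with hv
    have h1 : ∀ j, 0 ≤ B (u + e j + (m : ℝ) • v) (u + e j + (m : ℝ) • v)
        + m * (∑ j, θ j * B (e j) (e j) - B v v) := by
      intro j
      refine ih (u + e j) fun f => ?_
      have := h (Fin.cons j f)
      simpa [Fin.sum_univ_succ, add_assoc] using this
    have hexp : ∀ (w : E), ∑ j, θ j * B (w + e j) (w + e j)
        = B (w + v) (w + v) + (∑ j, θ j * B (e j) (e j) - B v v) := by
      intro w
      have e1 : B w v = ∑ j, θ j * B w (e j) := by simp [hv]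
      have e2 : B v w = ∑ j, θ j * B (e j) w := by simp [hv, LinearMap.sum_apply]
      have e3 : ∀ j, θ j * B (w + e j) (w + e j)
          = θ j * B w w + θ j * B w (e j) + θ j * B (e j) w + θ j * B (e j) (e j) := by
        intro j; simp only [map_add, LinearMap.add_apply]; ring
      simp only [e3, sum_add_distrib, ← sum_mul, hθ1, ← e1, ← e2]
      simp only [map_add, LinearMap.add_apply]; ring
    have h2 := sum_nonneg fun j (_ : j ∈ univ) => mul_nonneg (hθ j) (h1 j)
    have h3 : ∀ j, u + e j + (m : ℝ) • v = (u + (m : ℝ) • v) + e j := fun j => by abel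
    simp only [mul_add, sum_add_distrib, ← sum_mul, hθ1, one_mul, h3] at h2
    rw [hexp] at h2
    have h4 : u + ((m + 1 : ℕ) : ℝ) • v = u + (m : ℝ) • v + v := by
      push_cast; rw [add_smul, one_smul]; abel
    rw [h4]
    push_cast
    linarith

/-- A signed multiset of coordinate vectors. -/
def signedSum {p m : ℕ} (f : Fin m → Fin p × SignType) : Fin p → ℝ :=
  ∑ l, Pi.single (f l).1 ((f l).2 : ℝ)

/-- A quadratic form that is small on sums of `m + 1` signed coordinate vectors is bounded below
on the whole space. -/
lemma Matrix.le_dotProduct_mulVec_of_signedSum {p m : ℕ} (hm : 1 ≤ m)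
    (M : Matrix (Fin p) (Fin p) ℝ) {δ : ℝ} (hδ : 0 ≤ δ)
    (h : ∀ f : Fin (m + 1) → Fin p × SignType,
      |signedSum f ⬝ᵥ (M *ᵥ signedSum f)| ≤ δ * (signedSum f ⬝ᵥ signedSum f))
    (v : Fin p → ℝ) :
    -(δ * (v ⬝ᵥ v)) - 2 * δ * (∑ j, |v j|) ^ 2 / m ≤ v ⬝ᵥ (M *ᵥ v) := by
  set r := ∑ j, |v j| with hr
  have hr0 : 0 ≤ r := sum_nonneg fun _ _ => abs_nonneg _
  have hm0 : (0 : ℝ) < m := by exact_mod_cast hm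
  rcases hr0.eq_or_lt with hr0 | hr0
  · have hv : v = 0 := by
      funext j
      have := (sum_eq_zero_iff_of_nonneg (fun j _ => abs_nonneg (v j))).1 hr0.symm j (mem_univ j)
      simpa using this
    rw [← hr0, hv]; simp
  -- The shift by δ makes the form nonnegative on all signed sums. The atoms are the coordinate
  -- vectors carrying the signs of v, and v/‖v‖₁ is their convex combination with weights |v
  -- j|/‖v‖₁.
  set N := M + δ • (1 : Matrix (Fin p) (Fin p) ℝ) with hN
  set B := Matrix.toBilin' N with hB
  have hBapp : ∀ u, B u u = u ⬝ᵥ (M *ᵥ u) + δ * (u ⬝ᵥ u) := by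
    intro u
    rw [hB, Matrix.toBilin'_apply', hN, Matrix.add_mulVec, Matrix.smul_mulVec,
      Matrix.one_mulVec, dotProduct_add, dotProduct_smul, smul_eq_mul]
  set e : Fin p → Fin p → ℝ := fun j => Pi.single j (SignType.sign (v j) : ℝ) with he
  have hv : ∑ j, (|v j| / r) • e j = r⁻¹ • v := by
    funext i
    rw [Finset.sum_apply, Finset.sum_eq_single i (by intro b _ hb; simp [he, hb.symm]) (by simp)]
    simp only [Pi.smul_apply, he, Pi.single_eq_same, smul_eq_mul]
    have := sign_mul_abs (v i)
    field_simp
    linarith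
  have h1 := B.nonneg_of_nonneg_on_sums e (fun j => |v j| / r) (fun j => by positivity)
    (by rw [← sum_div, ← hr, div_self hr0.ne']) (m + 1) 0 (by
      intro f
      have := h fun l => (f l, SignType.sign (v (f l)))
      rw [zero_add, hBapp]
      have := neg_le_of_abs_le this
      simp only [signedSum] at this
      linarith)
  have hdiag : ∀ j, B (e j) (e j) ≤ 2 * δ := by
    intro j
    have h2 := h fun _ => (j, SignType.sign (v j))
    have h3 : signedSum (fun _ : Fin (m + 1) => (j, SignType.sign (v j))) = ((m : ℝ) + 1) • e j := by
      simp only [signedSum, sum_const, card_univ, Fintype.card_fin, he]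
      rw [← Nat.cast_smul_eq_nsmul ℝ]; push_cast; rfl
    rw [h3] at h2
    simp only [Matrix.mulVec_smul, dotProduct_smul, smul_dotProduct, smul_eq_mul] at h2
    have h4 := (le_abs_self _).trans h2
    have h5 : e j ⬝ᵥ (M *ᵥ e j) ≤ δ * (e j ⬝ᵥ e j) := by
      have : (0 : ℝ) < ((m : ℝ) + 1) * ((m : ℝ) + 1) := by positivity
      refine le_of_mul_le_mul_left ?_ this
      linarith
    have h6 : e j ⬝ᵥ e j ≤ 1 := by
      simp only [he, single_dotProduct, Pi.single_eq_same]
      rcases SignType.sign (v j) <;> simp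
    rw [hBapp]
    have := mul_le_mul_of_nonneg_left h6 hδ
    linarith
  have hD : ∑ j, |v j| / r * B (e j) (e j) ≤ 2 * δ := by
    calc _ ≤ ∑ j, |v j| / r * (2 * δ) :=
          sum_le_sum fun j _ => mul_le_mul_of_nonneg_left (hdiag j) (by positivity)
      _ = 2 * δ := by rw [← sum_mul, ← sum_div, ← hr, div_self hr0.ne', one_mul]
  rw [hv, zero_add] at h1
  have hscale : ∀ c : ℝ, B (c • v) (c • v) = c ^ 2 * B v v := by
    intro c; simp [pow_two, mul_assoc]
  rw [smul_smul, hscale, hscale] at h1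
  push_cast at h1
  -- With m + 1 atoms the mean contributes (m + 1)² and the variance removes m + 1 copies of the
  -- form at v/‖v‖₁. What remains is m(m + 1), so the final division is by m.
  have h2 : 0 ≤ ((m : ℝ) + 1) * (m * (r⁻¹ ^ 2 * B v v) + 2 * δ) := by
    calc _ ≤ _ := h1
      _ = ((m : ℝ) + 1) * (m * (r⁻¹ ^ 2 * B v v) + ∑ j, |v j| / r * B (e j) (e j)) := by ring
      _ ≤ _ := by gcongr
  have h3 : 0 ≤ m * (r⁻¹ ^ 2 * B v v) + 2 * δ := nonneg_of_mul_nonneg_right h2 (by positivity)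
  have h4 : 0 ≤ B v v + 2 * δ * r ^ 2 / m := by
    have := mul_nonneg h3 (show 0 ≤ r ^ 2 / m by positivity)
    calc _ ≤ _ := this
      _ = _ := by field_simp
  rw [hBapp] at h4
  linarith

end EmpiricalMethod

/-! ### Hölder-type bounds and the expansion of the objective. -/

section BasicInequality

variable {p : ℕ}

lemma abs_dotProduct_mulVec_le {M : Matrix (Fin p) (Fin p) ℝ} {D : ℝ} (hM : ∀ a b, |M a b| ≤ D)
    (u v : Fin p → ℝ) : |u ⬝ᵥ (M *ᵥ v)| ≤ D * (∑ a, |u a|) * ∑ b, |v b| := by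
  simp only [dotProduct, Matrix.mulVec]
  calc _ ≤ ∑ a, |u a * ∑ b, M a b * v b| := abs_sum_le_sum_abs _ _
    _ ≤ ∑ a, |u a| * ∑ b, D * |v b| := by
      refine sum_le_sum fun a _ => ?_
      rw [abs_mul]
      gcongr
      refine (abs_sum_le_sum_abs _ _).trans (sum_le_sum fun b _ => ?_)
      rw [abs_mul]; gcongr; exact hM a b
    _ = _ := by rw [← sum_mul, ← mul_sum]; ring

lemma abs_dotProduct_le {g : Fin p → ℝ} {D : ℝ} (hg : ∀ a, |g a| ≤ D) (u : Fin p → ℝ) :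
    |g ⬝ᵥ u| ≤ D * ∑ a, |u a| := by
  simp only [dotProduct]
  rw [mul_sum]
  refine (abs_sum_le_sum_abs _ _).trans (sum_le_sum fun a _ => ?_)
  rw [abs_mul]; gcongr; exact hg a

/-- The (unnormalised) Gram matrix of the rows with index in `A`. -/
def gram {ι : Type*} (A : Finset ι) (x : ι → EuclideanSpace ℝ (Fin p)) :
    Matrix (Fin p) (Fin p) ℝ := fun a b => ∑ i ∈ A, x i a * x i b

lemma dotProduct_gram_mulVec {ι : Type*} (A : Finset ι) (x : ι → EuclideanSpace ℝ (Fin p))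
    (u v : EuclideanSpace ℝ (Fin p)) :
    (u : Fin p → ℝ) ⬝ᵥ (gram A x *ᵥ (v : Fin p → ℝ))
      = ∑ i ∈ A, inner ℝ (x i) u * inner ℝ (x i) v := by
  simp only [dotProduct, Matrix.mulVec, gram, PiLp.inner_apply, RCLike.inner_apply,
    conj_trivial, sum_mul_sum]
  simp only [sum_mul, mul_sum]
  rw [sum_comm (s := A)]
  refine sum_congr rfl fun a _ => ?_
  rw [sum_comm]
  exact sum_congr rfl fun i _ => sum_congr rfl fun b _ => by ring

/-- Both cross terms are kept because Γ need not be symmetric: ties may be broken differently in the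
entries (a, b) and (b, a). -/
lemma quadObjective_sub (Γ : Matrix (Fin p) (Fin p) ℝ) (γ : Fin p → ℝ)
    (b β : EuclideanSpace ℝ (Fin p)) :
    quadObjective Γ γ b - quadObjective Γ γ β
      = 1 / 2 * (((b - β : EuclideanSpace ℝ (Fin p)) : Fin p → ℝ) ⬝ᵥ
            (Γ *ᵥ ((b - β : EuclideanSpace ℝ (Fin p)) : Fin p → ℝ)))
        + 1 / 2 * (((b - β : EuclideanSpace ℝ (Fin p)) : Fin p → ℝ) ⬝ᵥ (Γ *ᵥ (β : Fin p → ℝ))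
          + (β : Fin p → ℝ) ⬝ᵥ (Γ *ᵥ ((b - β : EuclideanSpace ℝ (Fin p)) : Fin p → ℝ)))
        - γ ⬝ᵥ ((b - β : EuclideanSpace ℝ (Fin p)) : Fin p → ℝ) := by
  simp only [quadObjective, WithLp.ofLp_sub, Matrix.mulVec_sub, dotProduct_sub, sub_dotProduct]
  ring

end BasicInequality

/-! ### Error bound for fixed data. -/

section DeterministicBound

variable {ι : Type*} [Fintype ι] {p : ℕ}

/-- Error bound for the robust Lasso on fixed data, from uniform bounds on the clean rows, a
bound on the noise correlations and a restricted eigenvalue condition. -/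
theorem IsRENOutput.error_bound {n nO k : ℕ} {C : Finset ι}
    {x : ι → EuclideanSpace ℝ (Fin p)} {ε y : ι → ℝ} {X : Matrix ι (Fin p) ℝ} {Y : ι → ℝ}
    {β b : EuclideanSpace ℝ (Fin p)} {κ Bx Bε By τ : ℝ}
    (hcard : Fintype.card ι = n + nO) (hβ : IsSparse k β)
    (hBx : 0 ≤ Bx) (hBε : 0 ≤ Bε) (hBy : 0 ≤ By) (hτ0 : 0 ≤ τ)
    (hx : ∀ i ∈ C, ∀ a, |x i a| ≤ Bx) (hε : ∀ i ∈ C, |ε i| ≤ Bε) (hy : ∀ i ∈ C, |y i| ≤ By)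
    (hlin : ∀ i ∈ C, y i = inner ℝ (x i) β + ε i)
    (hτ : ∀ a, |∑ i ∈ C, x i a * ε i| ≤ τ)
    (hRE : κ * ‖b - β‖ ^ 2 ≤ ∑ i ∈ C, inner ℝ (x i) (b - β) ^ 2)
    (hcor : IsCorruption n C x y X Y) (hb : IsRENOutput 1 (l1Norm β) n X Y b) :
    (κ - 12 * k * nO * Bx ^ 2) * ‖b - β‖ ≤
      4 * √(k : ℝ) * (τ + nO * Bx * Bε + 2 * nO * Bx * By + 2 * nO * Bx ^ 2 * (√(k : ℝ) * ‖β‖)) := by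
  obtain ⟨A', hA'C, hnA', hA'⟩ := hcor
  -- Exactly n unaltered rows are kept, so that the comparison set has the size of the trimmed sums.
  obtain ⟨A, hAA', hA⟩ := exists_subset_card_eq hnA'
  have hAC := hAA'.trans hA'C
  obtain ⟨Γ, γ, ⟨hΓ, hγ⟩, hbR, hmin⟩ := hb
  set v := b - β with hv
  have hcone : l1Norm v ≤ 2 * √(k : ℝ) * ‖v‖ := hβ.l1Norm_sub_le hbR
  have hβ1 := hβ.l1Norm_le
  have hl0 := l1Norm_nonneg v
  have hΓG : ∀ a b, |(Γ - gram A x) a b| ≤ 2 * nO * Bx ^ 2 := by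
    intro a b
    obtain ⟨t, ht, hΓt⟩ := hΓ a b
    have h1 := ht.abs_sub_sum_le hcard.le hA (sq_nonneg Bx) (by
      intro i hi
      rw [(hA' i (hAA' hi)).1 a, (hA' i (hAA' hi)).1 b, abs_mul, pow_two]
      exact mul_le_mul (hx i (hAC hi) a) (hx i (hAC hi) b) (abs_nonneg _) hBx)
    have h2 : ∑ i ∈ A, X i a * X i b = gram A x a b :=
      sum_congr rfl fun i hi => by rw [(hA' i (hAA' hi)).1 a, (hA' i (hAA' hi)).1 b]
    rw [h2] at h1
    simpa [hΓt] using h1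
  have hγg : ∀ a, |(γ - fun a => ∑ i ∈ A, x i a * y i) a| ≤ 2 * nO * (Bx * By) := by
    intro a
    have h1 := (hγ a).abs_sub_sum_le hcard.le hA (mul_nonneg hBx hBy) (by
      intro i hi
      rw [(hA' i (hAA' hi)).1 a, (hA' i (hAA' hi)).2, abs_mul]
      exact mul_le_mul (hx i (hAC hi) a) (hy i (hAC hi)) (abs_nonneg _) hBx)
    have h2 : ∑ i ∈ A, X i a * Y i = ∑ i ∈ A, x i a * y i :=
      sum_congr rfl fun i hi => by rw [(hA' i (hAA' hi)).1 a, (hA' i (hAA' hi)).2]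
    rw [h2] at h1
    simpa using h1
  have hsplit : ∀ u w : EuclideanSpace ℝ (Fin p),
      |(u : Fin p → ℝ) ⬝ᵥ (Γ *ᵥ (w : Fin p → ℝ)) - ∑ i ∈ A, inner ℝ (x i) u * inner ℝ (x i) w|
        ≤ 2 * nO * Bx ^ 2 * l1Norm u * l1Norm w := by
    intro u w
    rw [← dotProduct_gram_mulVec, ← dotProduct_sub, ← Matrix.sub_mulVec]
    exact abs_dotProduct_mulVec_le hΓG _ _
  have hγv : |γ ⬝ᵥ (v : Fin p → ℝ) - ∑ i ∈ A, inner ℝ (x i) v * y i|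
      ≤ 2 * nO * (Bx * By) * l1Norm v := by
    have h1 : ∑ i ∈ A, inner ℝ (x i) v * y i
        = (fun a => ∑ i ∈ A, x i a * y i) ⬝ᵥ (v : Fin p → ℝ) := by
      simp only [dotProduct, PiLp.inner_apply, RCLike.inner_apply, conj_trivial, sum_mul]
      rw [sum_comm]
      exact sum_congr rfl fun a _ => sum_congr rfl fun i _ => by ring
    rw [h1, ← sub_dotProduct]
    exact abs_dotProduct_le hγg _
  have hnoise : |∑ i ∈ A, inner ℝ (x i) v * ε i| ≤ (τ + nO * (Bx * Bε)) * l1Norm v := by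
    have h1 : ∑ i ∈ A, inner ℝ (x i) v * ε i
        = (fun a => ∑ i ∈ A, x i a * ε i) ⬝ᵥ (v : Fin p → ℝ) := by
      simp only [dotProduct, PiLp.inner_apply, RCLike.inner_apply, conj_trivial, sum_mul]
      rw [sum_comm]
      exact sum_congr rfl fun a _ => sum_congr rfl fun i _ => by ring
    rw [h1]
    refine abs_dotProduct_le (fun a => ?_) _
    have h2 := abs_sum_sub_sum_subset_le (f := fun i => x i a * ε i) hcard.le hA hAC
      (mul_nonneg hBx hBε) (fun i hi => by
        rw [abs_mul]; exact mul_le_mul (hx i hi a) (hε i hi) (abs_nonneg _) hBx)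
    have h3 := hτ a
    rw [abs_le] at h2 h3 ⊢
    constructor <;> linarith [h2.1, h2.2, h3.1, h3.2]
  have hquad : ∑ i ∈ C, inner ℝ (x i) v ^ 2 - nO * (Bx * l1Norm v) ^ 2
      ≤ ∑ i ∈ A, inner ℝ (x i) v ^ 2 := by
    have h2 := abs_sum_sub_sum_subset_le (f := fun i => inner ℝ (x i) v ^ 2) hcard.le hA hAC
      (sq_nonneg (Bx * l1Norm v)) (fun i hi => by
        rw [abs_of_nonneg (sq_nonneg _)]
        apply sq_le_sq'
        · have h := neg_abs_le (inner ℝ (x i) v)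
          have h1 : |inner ℝ (x i) v| ≤ Bx * l1Norm v := by
            rw [real_inner_comm]
            simp only [PiLp.inner_apply, RCLike.inner_apply, conj_trivial]
            exact abs_dotProduct_le (hx i hi) v
          linarith
        · refine (le_abs_self _).trans ?_
          rw [real_inner_comm]
          simp only [PiLp.inner_apply, RCLike.inner_apply, conj_trivial]
          exact abs_dotProduct_le (hx i hi) v)
    linarith [le_of_abs_le h2]
  have hobj := hmin β le_rfl
  have hdiff := quadObjective_sub Γ γ b β
  rw [← hv] at hdiff
  have hy' : ∑ i ∈ A, inner ℝ (x i) v * y i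
      = ∑ i ∈ A, inner ℝ (x i) v * inner ℝ (x i) β + ∑ i ∈ A, inner ℝ (x i) v * ε i := by
    rw [← sum_add_distrib]
    exact sum_congr rfl fun i hi => by rw [hlin i (hAC hi)]; ring
  have hvv := abs_le.1 (hsplit v v)
  have hvβ := abs_le.1 (hsplit v β)
  have hβv := abs_le.1 (hsplit β v)
  have hcomm : ∑ i ∈ A, inner ℝ (x i) β * inner ℝ (x i) v
      = ∑ i ∈ A, inner ℝ (x i) v * inner ℝ (x i) β := sum_congr rfl fun i _ => mul_comm _ _
  have hsq : ∑ i ∈ A, inner ℝ (x i) v * inner ℝ (x i) v = ∑ i ∈ A, inner ℝ (x i) v ^ 2 :=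
    sum_congr rfl fun i _ => (pow_two _).symm
  rw [hcomm] at hβv
  rw [hsq] at hvv
  rw [hy'] at hγv
  have hγv' := abs_le.1 hγv
  have hnoise' := abs_le.1 hnoise
  -- The signal terms in γ and in the cross terms cancel. Of the factor 3, two parts come from
  -- trimming in Γ and one from replacing C by A in the restricted eigenvalue bound; the cone
  -- inequality later turns 3 into 12k.
  have h0 : 1 / 2 * (κ * ‖v‖ ^ 2 - 3 * (nO * Bx ^ 2) * l1Norm v ^ 2)
      ≤ (τ + nO * (Bx * Bε) + 2 * nO * (Bx * By) + 2 * nO * Bx ^ 2 * l1Norm β) * l1Norm v := by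
    nlinarith [hvv.1, hvβ.1, hβv.1, hγv'.2, hnoise'.2]
  have hk : √(k : ℝ) ^ 2 = k := Real.sq_sqrt (by positivity)
  have hl2 : l1Norm v ^ 2 ≤ 4 * k * ‖v‖ ^ 2 := by
    calc l1Norm v ^ 2 ≤ (2 * √(k : ℝ) * ‖v‖) ^ 2 := by gcongr
      _ = _ := by rw [mul_pow, mul_pow, hk]; ring
  rcases (norm_nonneg v).eq_or_lt with hv0 | hv0
  · rw [← hv0, mul_zero]
    positivity
  have h1 : (κ - 12 * k * nO * Bx ^ 2) * ‖v‖ ^ 2 ≤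
      4 * √(k : ℝ) * (τ + nO * Bx * Bε + 2 * nO * Bx * By
        + 2 * nO * Bx ^ 2 * (√(k : ℝ) * ‖β‖)) * ‖v‖ := by
    have h2 := mul_le_mul_of_nonneg_left hl2 (show 0 ≤ 3 * (nO * Bx ^ 2) by positivity)
    have h3 : (τ + nO * (Bx * Bε) + 2 * nO * (Bx * By) + 2 * nO * Bx ^ 2 * l1Norm β) * l1Norm v
        ≤ (τ + nO * (Bx * Bε) + 2 * nO * (Bx * By) + 2 * nO * Bx ^ 2 * (√(k : ℝ) * ‖β‖))
          * (2 * √(k : ℝ) * ‖v‖) := by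
      gcongr
    linarith
  refine le_of_mul_le_mul_right ?_ hv0
  linarith

end DeterministicBound

/-! ### The smallest eigenvalue as a lower bound for the quadratic form. -/

section SmallestEigenvalue

variable {p : ℕ}

lemma lambdaMin_pos [NeZero p] {S : Matrix (Fin p) (Fin p) ℝ} (hS : S.PosDef) :
    0 < lambdaMin hS.isHermitian := by
  obtain ⟨j, hj⟩ := exists_eq_ciInf_of_finite (f := hS.isHermitian.eigenvalues)
  rw [lambdaMin, ← hj]
  exact hS.eigenvalues_pos j

lemma lambdaMin_mul_norm_sq_le {S : Matrix (Fin p) (Fin p) ℝ} (hS : S.IsHermitian)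
    (v : EuclideanSpace ℝ (Fin p)) :
    lambdaMin hS * ‖v‖ ^ 2 ≤ (v : Fin p → ℝ) ⬝ᵥ (S *ᵥ (v : Fin p → ℝ)) := by
  have hsymm : (Matrix.toEuclideanLin S).IsSymmetric := Matrix.isSymmetric_toEuclideanLin_iff.2 hS
  have h1 : (v : Fin p → ℝ) ⬝ᵥ (S *ᵥ (v : Fin p → ℝ))
      = inner ℝ v (Matrix.toEuclideanLin S v) := by
    simp only [PiLp.inner_apply, RCLike.inner_apply, conj_trivial, dotProduct]
    exact sum_congr rfl fun j _ => mul_comm _ _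
  have h2 : ∀ j, Matrix.toEuclideanLin S (hS.eigenvectorBasis j)
      = hS.eigenvalues j • hS.eigenvectorBasis j := by
    intro j
    ext i
    exact congrFun (hS.mulVec_eigenvectorBasis j) i
  rw [h1, ← hS.eigenvectorBasis.sum_inner_mul_inner, ← real_inner_self_eq_norm_sq,
    ← hS.eigenvectorBasis.sum_inner_mul_inner, mul_sum]
  refine sum_le_sum fun j _ => ?_
  rw [← hsymm, h2, real_inner_smul_left, real_inner_comm v]
  have h3 : lambdaMin hS ≤ hS.eigenvalues j := ciInf_le (Set.finite_range _).bddBelow j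
  have := mul_le_mul_of_nonneg_right h3 (mul_self_nonneg (inner ℝ v (hS.eigenvectorBasis j)))
  linarith

end SmallestEigenvalue

/-! ### Moments and concentration in the linear model. -/

section Model

variable {Ω ι : Type*} [MeasurableSpace Ω] {μ : Measure Ω} {p n : ℕ}
  {C : Finset ι} {S : Matrix (Fin p) (Fin p) ℝ} {σx σε : ℝ≥0} {β : EuclideanSpace ℝ (Fin p)}
  {x : ι → Ω → EuclideanSpace ℝ (Fin p)} {ε y : ι → Ω → ℝ}

namespace SubGaussianLinearModel

lemma hasSubgaussianMGF_coord (h : SubGaussianLinearModel μ n C S σx σε β x ε y) {i : ι}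
    (hi : i ∈ C) (a : Fin p) :
    HasSubgaussianMGF (fun ω => x i ω a) (σx ^ 2 / n) μ := by
  have h1 := h.subGaussian_x i hi (EuclideanSpace.single a 1) (by simp)
  simpa [EuclideanSpace.inner_single_left] using h1

lemma iIndepFun_inner (h : SubGaussianLinearModel μ n C S σx σε β x ε y)
    (w : EuclideanSpace ℝ (Fin p)) :
    iIndepFun (fun (i : C) ω => inner ℝ w (x i ω)) μ :=
  h.indep_samples.comp (fun _ z => inner ℝ w z.1) (fun _ => by fun_prop)

lemma integral_coord_mul_noise (h : SubGaussianLinearModel μ n C S σx σε β x ε y) {i : ι}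
    (hi : i ∈ C) (a : Fin p) : ∫ ω, x i ω a * ε i ω ∂μ = 0 := by
  have hind : IndepFun (fun ω => x i ω a) (ε i) μ :=
    (h.indep_noise i hi).comp (φ := fun z : EuclideanSpace ℝ (Fin p) => z a) (ψ := id) (by fun_prop) measurable_id
  rw [hind.integral_fun_mul_eq_mul_integral
    (h.hasSubgaussianMGF_coord hi a).aestronglyMeasurable
    (h.subGaussian_noise i hi).aestronglyMeasurable, h.mean_zero i hi a, zero_mul]

variable [IsProbabilityMeasure μ]

lemma hasSubgaussianMGF_inner (h : SubGaussianLinearModel μ n C S σx σε β x ε y) {i : ι}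
    (hi : i ∈ C) (w : EuclideanSpace ℝ (Fin p)) :
    HasSubgaussianMGF (fun ω => inner ℝ w (x i ω)) (‖w‖₊ ^ 2 * (σx ^ 2 / n)) μ := by
  rcases eq_or_ne w 0 with rfl | hw
  · simp
  have h1 := (h.subGaussian_x i hi (‖w‖⁻¹ • w) (norm_smul_inv_norm hw)).const_mul ‖w‖
  have h2 : ‖w‖ ≠ 0 := norm_ne_zero_iff.2 hw
  convert h1 using 2 with ω
  · rw [real_inner_smul_left, ← mul_assoc, mul_inv_cancel₀ h2, one_mul]
  · congr 1

lemma integral_inner_sq (h : SubGaussianLinearModel μ n C S σx σε β x ε y) {i : ι}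
    (hi : i ∈ C) (w : EuclideanSpace ℝ (Fin p)) :
    ∫ ω, inner ℝ w (x i ω) ^ 2 ∂μ = (w : Fin p → ℝ) ⬝ᵥ (S *ᵥ (w : Fin p → ℝ)) / n := by
  have hL : ∀ a, MemLp (fun ω => x i ω a) 2 μ := fun a => (h.hasSubgaussianMGF_coord hi a).memLp 2
  have hprod : ∀ a b, ∫ ω, x i ω a * x i ω b ∂μ = S a b / n := by
    intro a b
    rw [← h.covariance_eq i hi a b, covariance_eq_sub (hL a) (hL b), h.mean_zero i hi a, zero_mul,
      sub_zero]
    rfl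
  have hint : ∀ a b, Integrable (fun ω => x i ω a * x i ω b) μ := fun a b =>
    (hL a).integrable_mul (hL b)
  have hexp : ∀ ω, inner ℝ w (x i ω) ^ 2 = ∑ a, ∑ b, (w a * w b) * (x i ω a * x i ω b) := by
    intro ω
    simp only [PiLp.inner_apply, RCLike.inner_apply, conj_trivial, pow_two, sum_mul_sum]
    exact sum_congr rfl fun a _ => sum_congr rfl fun b _ => by ring
  simp_rw [hexp]
  rw [integral_finsetSum _ fun a _ => integrable_finsetSum _ fun b _ => (hint a b).const_mul _]
  simp only [dotProduct, Matrix.mulVec, sum_div, mul_sum]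
  refine sum_congr rfl fun a _ => ?_
  rw [integral_finsetSum _ fun b _ => (hint a b).const_mul _]
  refine sum_congr rfl fun b _ => ?_
  rw [integral_const_mul, hprod]
  ring

lemma hasSubgaussianMGF_response (h : SubGaussianLinearModel μ n C S σx σε β x ε y) {i : ι}
    (hi : i ∈ C) :
    HasSubgaussianMGF (y i) (‖β‖₊ ^ 2 * (σx ^ 2 / n) + σε ^ 2 / n) μ := by
  have hind : IndepFun (fun ω => inner ℝ β (x i ω)) (ε i) μ :=
    (h.indep_noise i hi).comp (φ := fun z => inner ℝ β z) (ψ := id) (by fun_prop) measurable_id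
  have h1 := (h.hasSubgaussianMGF_inner hi β).add_of_indepFun (h.subGaussian_noise i hi) hind
  convert h1 using 2 with ω
  rw [h.linear_model i hi, real_inner_comm]

/-- A coordinate direction has variance at least the smallest eigenvalue over n and at most four
times its variance proxy. This comparison makes σx positive and turns the hypotheses on n and nO
into scale-free ones. -/
lemma lambdaMin_le (h : SubGaussianLinearModel μ n C S σx σε β x ε y) (hS : S.IsHermitian)
    (hp : 0 < p) (hn : 0 < n) (hC : C.Nonempty) : lambdaMin hS ≤ 4 * (σx : ℝ) ^ 2 := by
  obtain ⟨i, hi⟩ := hC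
  have hn' : (0 : ℝ) < n := by exact_mod_cast hn
  set w : EuclideanSpace ℝ (Fin p) := EuclideanSpace.single ⟨0, hp⟩ 1 with hw
  have hw1 : ‖w‖ = 1 := by simp [hw]
  have h1 := lambdaMin_mul_norm_sq_le hS w
  have h2 := (h.subGaussian_x i hi w hw1).integral_sq_le
  rw [h.integral_inner_sq hi w] at h2
  push_cast at h2
  rw [mul_div_assoc', div_le_div_iff_of_pos_right hn'] at h2
  rw [hw1] at h1
  linarith

end SubGaussianLinearModel

variable [IsProbabilityMeasure μ]

/-- Bernstein's inequality for squares, with the free parameter optimised. -/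
lemma measureReal_abs_sum_sq_sub_gt_le_of_le {κ : Type*} [Fintype κ] {Z : κ → Ω → ℝ} {c : ℝ≥0}
    (hc : c ≠ 0) (hind : iIndepFun Z μ) (h : ∀ i, HasSubgaussianMGF (Z i) c μ)
    (hn : 0 < n) (hcard : Fintype.card κ ≤ 2 * n) {t : ℝ} (ht0 : 0 ≤ t) (ht : t ≤ 128 * n * c) :
    μ.real {ω | t < |∑ i, (Z i ω ^ 2 - ∫ ω', Z i ω' ^ 2 ∂μ)|}
      ≤ 2 * Real.exp (-(t ^ 2 / (2048 * n * c ^ 2))) := by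
  have hc' : (0 : ℝ) < c := by positivity
  have hn' : (0 : ℝ) < n := by exact_mod_cast hn
  have hcard' : (Fintype.card κ : ℝ) ≤ 2 * n := by exact_mod_cast hcard
  -- This parameter minimises -s t + 512 n c² s², the exponent when there are at most 2n summands;
  -- the range of t keeps it below 1/(8c).
  have hs : t / (1024 * n * c ^ 2) ≤ 1 / (8 * (c : ℝ)) := by
    rw [div_le_div_iff₀ (by positivity) (by positivity)]
    calc t * (8 * c) ≤ 128 * n * c * (8 * c) := by gcongr
      _ = _ := by ring
  refine (measureReal_abs_sum_sq_sub_gt_le (t := t) hc hind h (s := t / (1024 * n * c ^ 2))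
    (by positivity) hs).trans ?_
  gcongr
  calc _ ≤ -(t / (1024 * n * c ^ 2) * t)
        + (2 * n) * (256 * c ^ 2 * (t / (1024 * n * c ^ 2)) ^ 2) := by gcongr
    _ = _ := by field_simp; ring

namespace SubGaussianLinearModel

/-- Concentration of the empirical second moment in a fixed direction. -/
lemma measureReal_abs_sum_inner_sq_gt_le (h : SubGaussianLinearModel μ n C S σx σε β x ε y)
    (hn : 0 < n) (hC : #C ≤ 2 * n) (hσ : σx ≠ 0) {δ : ℝ} (hδ0 : 0 ≤ δ)
    (hδ : δ ≤ 128 * (σx : ℝ) ^ 2) (w : EuclideanSpace ℝ (Fin p)) :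
    μ.real {ω | δ * ‖w‖ ^ 2 < |∑ i ∈ C, inner ℝ w (x i ω) ^ 2
        - (#C / n : ℝ) * ((w : Fin p → ℝ) ⬝ᵥ (S *ᵥ (w : Fin p → ℝ)))|}
      ≤ 2 * Real.exp (-(n * δ ^ 2 / (2048 * (σx : ℝ) ^ 4))) := by
  have hn' : (0 : ℝ) < n := by exact_mod_cast hn
  rcases eq_or_ne w 0 with rfl | hw
  · simp; positivity
  have hw' : (0 : ℝ) < ‖w‖ := norm_pos_iff.2 hw
  have hσ' : (0 : ℝ) < σx := by positivity
  have hc : (‖w‖₊ ^ 2 * (σx ^ 2 / n) : ℝ≥0) ≠ 0 := by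
    have : (n : ℝ≥0) ≠ 0 := by exact_mod_cast hn.ne'
    have : ‖w‖₊ ≠ 0 := nnnorm_ne_zero_iff.2 hw
    positivity
  have h1 := measureReal_abs_sum_sq_sub_gt_le_of_le (n := n) hc (h.iIndepFun_inner w)
    (fun i => h.hasSubgaussianMGF_inner i.2 w) hn (by simpa using hC)
    (t := δ * ‖w‖ ^ 2) (by positivity) (by
      push_cast
      calc δ * ‖w‖ ^ 2 ≤ 128 * (σx : ℝ) ^ 2 * ‖w‖ ^ 2 := by gcongr
        _ = _ := by field_simp)
  have h2 : ∀ ω, ∑ i : C, (inner ℝ w (x i ω) ^ 2 - ∫ ω', inner ℝ w (x i ω') ^ 2 ∂μ)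
      = ∑ i ∈ C, inner ℝ w (x i ω) ^ 2
        - (#C / n : ℝ) * ((w : Fin p → ℝ) ⬝ᵥ (S *ᵥ (w : Fin p → ℝ))) := by
    intro ω
    rw [sum_sub_distrib, sum_coe_sort C fun i => inner ℝ w (x i ω) ^ 2,
      sum_congr rfl fun (i : C) _ => h.integral_inner_sq i.2 w]
    simp
    ring
  simp_rw [h2] at h1
  refine h1.trans (le_of_eq ?_)
  congr 3
  push_cast
  field_simp

/-- Concentration of the empirical correlation between a covariate and the noise. -/
lemma measureReal_abs_sum_coord_mul_noise_gt_le
    (h : SubGaussianLinearModel μ n C S σx σε β x ε y)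
    (hn : 0 < n) (hC : #C ≤ 2 * n) (hσ : σx ≠ 0) {r : ℝ} (hr0 : 0 ≤ r)
    (hr : r ≤ 128) (a : Fin p) :
    μ.real {ω | σx * σε * r < |∑ i ∈ C, x i ω a * ε i ω|}
      ≤ 4 * Real.exp (-(n * r ^ 2 / 2048)) := by
  have hn' : (0 : ℝ) < n := by exact_mod_cast hn
  have hσ' : (0 : ℝ) < σx := by positivity
  rcases eq_or_ne σε 0 with rfl | hσε
  · have h0 : μ {ω | σx * ((0 : ℝ≥0) : ℝ) * r < |∑ i ∈ C, x i ω a * ε i ω|} = 0 := by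
      rw [measure_eq_zero_iff_ae_notMem]
      have h1 : ∀ i ∈ C, ∀ᵐ ω ∂μ, ε i ω = 0 := fun i hi => by
        have := h.subGaussian_noise i hi
        rw [zero_pow two_ne_zero, zero_div] at this
        exact this.ae_eq_zero_of_hasSubgaussianMGF_zero
      have h2 : ∀ᵐ ω ∂μ, ∀ i ∈ C, ε i ω = 0 := (Finset.eventually_all C).2 h1
      filter_upwards [h2] with ω hω
      have : ∑ i ∈ C, x i ω a * ε i ω = 0 := sum_eq_zero fun i hi => by rw [hω i hi, mul_zero]
      simp [this]
    rw [measureReal_def, h0]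
    simp only [ENNReal.toReal_zero]
    positivity
  have hσε' : (0 : ℝ) < σε := by positivity
  set c : ℝ≥0 := 2 * σx ^ 2 * σε ^ 2 / n with hcdef
  have hc : c ≠ 0 := by
    have : (n : ℝ≥0) ≠ 0 := by exact_mod_cast hn.ne'
    positivity
  have hcr : (c : ℝ) = 2 * σx ^ 2 * σε ^ 2 / n := by rw [hcdef]; push_cast; rfl
  -- Polarisation: P² - Q² = 4 σx σε x ε. The weights balance the two variance proxies, and P² and
  -- Q² have the same mean because x ε has mean zero, so the product sum is a difference of two
  -- centred sums of squares.
  set P : ι → Ω → ℝ := fun i ω => σε * x i ω a + σx * ε i ω with hP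
  set Q : ι → Ω → ℝ := fun i ω => σε * x i ω a - σx * ε i ω with hQ
  have hx' : ∀ i ∈ C, HasSubgaussianMGF (fun ω => σε * x i ω a) (σε ^ 2 * (σx ^ 2 / n)) μ :=
    fun i hi => (h.hasSubgaussianMGF_coord hi a).const_mul σε
  have hε' : ∀ i ∈ C, HasSubgaussianMGF (fun ω => σx * ε i ω) (σx ^ 2 * (σε ^ 2 / n)) μ :=
    fun i hi => (h.subGaussian_noise i hi).const_mul σx
  have hind : ∀ i ∈ C, IndepFun (fun ω => σε * x i ω a) (fun ω => σx * ε i ω) μ := fun i hi =>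
    (h.indep_noise i hi).comp (φ := fun z : EuclideanSpace ℝ (Fin p) => (σε : ℝ) * z a)
      (ψ := fun z : ℝ => (σx : ℝ) * z)
      (by fun_prop) (by fun_prop)
  have hceq : σε ^ 2 * (σx ^ 2 / n) + σx ^ 2 * (σε ^ 2 / n) = c := by rw [hcdef]; ring
  have hPs : ∀ i ∈ C, HasSubgaussianMGF (P i) c μ := fun i hi =>
    hceq ▸ (hx' i hi).add_of_indepFun (hε' i hi) (hind i hi)
  have hQs : ∀ i ∈ C, HasSubgaussianMGF (Q i) c μ := fun i hi =>
    hceq ▸ (hx' i hi).sub_of_indepFun (hε' i hi) (hind i hi)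
  have hPi : iIndepFun (fun i : C => P i) μ :=
    h.indep_samples.comp (fun _ z => σε * z.1 a + σx * z.2) (fun _ => by fun_prop)
  have hQi : iIndepFun (fun i : C => Q i) μ :=
    h.indep_samples.comp (fun _ z => σε * z.1 a - σx * z.2) (fun _ => by fun_prop)
  have hmean : ∀ i ∈ C, ∫ ω, P i ω ^ 2 ∂μ = ∫ ω, Q i ω ^ 2 ∂μ := by
    intro i hi
    rw [← sub_eq_zero, ← integral_sub ((hPs i hi).memLp 2).integrable_sq
      ((hQs i hi).memLp 2).integrable_sq]
    have : ∀ ω, P i ω ^ 2 - Q i ω ^ 2 = 4 * σx * σε * (x i ω a * ε i ω) := by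
      intro ω; simp only [hP, hQ]; ring
    simp_rw [this]
    rw [integral_const_mul, h.integral_coord_mul_noise hi a, mul_zero]
  have hcn : c * n = 2 * (σx : ℝ) ^ 2 * σε ^ 2 := by rw [hcr]; field_simp
  have ht : (c * n * r : ℝ) ≤ 128 * n * c := by
    calc (c * n * r : ℝ) ≤ c * n * 128 := by gcongr
      _ = _ := by ring
  have b1 := measureReal_abs_sum_sq_sub_gt_le_of_le (n := n) hc hPi (fun i => hPs i i.2) hn
    (by simpa using hC) (t := c * n * r) (by positivity) ht
  have b2 := measureReal_abs_sum_sq_sub_gt_le_of_le (n := n) hc hQi (fun i => hQs i i.2) hn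
    (by simpa using hC) (t := c * n * r) (by positivity) ht
  have hc0 : (c : ℝ) ≠ 0 := by exact_mod_cast hc
  have he : (c * n * r : ℝ) ^ 2 / (2048 * n * c ^ 2) = n * r ^ 2 / 2048 := by field_simp
  rw [he] at b1 b2
  have hsub : {ω | σx * σε * r < |∑ i ∈ C, x i ω a * ε i ω|} ⊆
      {ω | c * n * r < |∑ i : C, (P i ω ^ 2 - ∫ ω', P i ω' ^ 2 ∂μ)|} ∪
      {ω | c * n * r < |∑ i : C, (Q i ω ^ 2 - ∫ ω', Q i ω' ^ 2 ∂μ)|} := by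
    intro ω hω
    simp only [Set.mem_union, Set.mem_ofPred_eq] at hω ⊢
    by_contra! hcon
    have e1 : ∑ i : C, (P i ω ^ 2 - ∫ ω', P i ω' ^ 2 ∂μ)
        - ∑ i : C, (Q i ω ^ 2 - ∫ ω', Q i ω' ^ 2 ∂μ)
        = 4 * (σx * σε) * ∑ i ∈ C, x i ω a * ε i ω := by
      rw [← sum_sub_distrib, ← sum_coe_sort C fun i => x i ω a * ε i ω, mul_sum]
      refine sum_congr rfl fun i _ => ?_
      rw [hmean i i.2]
      simp only [hP, hQ]; ring
    have e2 : 4 * (σx * σε) * |∑ i ∈ C, x i ω a * ε i ω| ≤ 2 * (c * n * r) := by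
      rw [← abs_of_nonneg (show (0 : ℝ) ≤ 4 * (σx * σε) by positivity), ← abs_mul, ← e1]
      have e3 := abs_le.1 hcon.1
      have e4 := abs_le.1 hcon.2
      exact abs_le.2 ⟨by linarith [e3.1, e4.2], by linarith [e3.2, e4.1]⟩
    have e3 : 4 * (σx * σε : ℝ) * (σx * σε * r) < 4 * (σx * σε) * |∑ i ∈ C, x i ω a * ε i ω| :=
      mul_lt_mul_of_pos_left hω (by positivity)
    rw [hcn] at e2
    linarith
  calc _ ≤ _ := measureReal_mono hsub
    _ ≤ _ := measureReal_union_le _ _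
    _ ≤ _ := by linarith

end SubGaussianLinearModel

end Model

/-! ### Union bounds and the good event. -/

section Events

variable {Ω : Type*} [MeasurableSpace Ω] {μ : Measure Ω}

lemma measureReal_biUnion_le_card_mul {κ : Type*} (s : Finset κ) {B : κ → Set Ω} {q : ℝ}
    (h : ∀ j ∈ s, μ.real (B j) ≤ q) : μ.real (⋃ j ∈ s, B j) ≤ #s * q := by
  refine (measureReal_biUnion_finset_le s B).trans ?_
  rw [← nsmul_eq_mul]
  exact sum_le_card_nsmul _ _ _ h

variable [IsProbabilityMeasure μ]

/-- The complement of a measurable hull of `B` works, so the bad set need not be shown measurable.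
-/
lemma exists_measurableSet_disjoint {B : Set Ω} {q : ℝ} (h : μ.real B < q) :
    ∃ E, MeasurableSet E ∧ 1 - q < μ.real E ∧ ∀ ω ∈ E, ω ∉ B := by
  refine ⟨(toMeasurable μ B)ᶜ, (measurableSet_toMeasurable μ B).compl, ?_,
    fun ω hω hB => hω (subset_toMeasurable μ B hB)⟩
  rw [probReal_compl_eq_one_sub (measurableSet_toMeasurable μ B), measureReal_def,
    measure_toMeasurable, ← measureReal_def]
  linarith

variable {ι : Type*} {p n k : ℕ}
  {C : Finset ι} {S : Matrix (Fin p) (Fin p) ℝ} {σx σε : ℝ≥0} {β : EuclideanSpace ℝ (Fin p)}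
  {x : ι → Ω → EuclideanSpace ℝ (Fin p)} {ε y : ι → Ω → ℝ}

/-- With high probability all clean covariates, noises and responses are of the typical size, the
noise is nearly uncorrelated with the covariates, and the empirical second moments are close to
the population ones along all sums of `2 k` signed coordinate vectors. -/
theorem SubGaussianLinearModel.exists_good_event
    (h : SubGaussianLinearModel μ n C S σx σε β x ε y) (hn : 0 < n) (hnp : n ≤ p)
    (hC : #C ≤ 2 * n) (hσ : σx ≠ 0) (hp : 5 ≤ p) (hk : 1 ≤ k) (hlog : Real.log p ≤ n)
    {δ : ℝ} (hδ0 : 0 ≤ δ) (hδ : δ ≤ 128 * (σx : ℝ) ^ 2)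
    (hδn : 15 * k * Real.log p ≤ n * δ ^ 2 / (2048 * (σx : ℝ) ^ 4)) :
    ∃ E : Set Ω, MeasurableSet E ∧ 1 - 1 / (p : ℝ) ^ 2 < μ.real E ∧ ∀ ω ∈ E,
      (∀ i ∈ C, ∀ a, x i ω a ^ 2 ≤ 12 * Real.log p / n * (σx : ℝ) ^ 2) ∧
      (∀ i ∈ C, ε i ω ^ 2 ≤ 12 * Real.log p / n * (σε : ℝ) ^ 2) ∧
      (∀ i ∈ C, y i ω ^ 2 ≤ 12 * Real.log p / n * ((σε : ℝ) ^ 2 + (σx : ℝ) ^ 2 * ‖β‖ ^ 2)) ∧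
      (∀ a, |∑ i ∈ C, x i ω a * ε i ω| ≤ σx * σε * (112 * √(Real.log p / n))) ∧
      ∀ f : Fin (2 * k) → Fin p × SignType,
        |∑ i ∈ C, inner ℝ (WithLp.toLp 2 (signedSum f)) (x i ω) ^ 2
          - (#C / n : ℝ) * (signedSum f ⬝ᵥ (S *ᵥ signedSum f))|
        ≤ δ * (signedSum f ⬝ᵥ signedSum f) := by
  classical
  have hn' : (0 : ℝ) < n := by exact_mod_cast hn
  have hp' : (5 : ℝ) ≤ p := by exact_mod_cast hp
  have hp0 : (0 : ℝ) < p := by linarith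
  have hσ' : (0 : ℝ) < σx := by positivity
  set L := Real.log p with hL
  have hL0 : 0 < L := Real.log_pos (by linarith)
  have hexp : ∀ m : ℕ, Real.exp (-(m * L)) = ((p : ℝ) ^ m)⁻¹ := fun m => by
    rw [Real.exp_neg, Real.exp_nat_mul, Real.exp_log hp0]
  have hexp6 : Real.exp (-(6 * L)) = ((p : ℝ) ^ 6)⁻¹ := by exact_mod_cast hexp 6
  have hC2 : (#C : ℝ) ≤ 2 * p := by
    have : #C ≤ 2 * p := by omega
    exact_mod_cast this
  set B₁ : Set Ω := ⋃ ia ∈ C ×ˢ (univ : Finset (Fin p)),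
    {ω | 12 * L / n * (σx : ℝ) ^ 2 < x ia.1 ω ia.2 ^ 2} with hB₁
  set B₂ : Set Ω := ⋃ i ∈ C, {ω | 12 * L / n * (σε : ℝ) ^ 2 < ε i ω ^ 2} with hB₂
  set B₃ : Set Ω := ⋃ i ∈ C,
    {ω | 12 * L / n * ((σε : ℝ) ^ 2 + (σx : ℝ) ^ 2 * ‖β‖ ^ 2) < y i ω ^ 2} with hB₃
  set B₄ : Set Ω := ⋃ a ∈ (univ : Finset (Fin p)),
    {ω | σx * σε * (112 * √(L / n)) < |∑ i ∈ C, x i ω a * ε i ω|} with hB₄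
  set B₅ : Set Ω := ⋃ f ∈ (univ : Finset (Fin (2 * k) → Fin p × SignType)),
    {ω | δ * (signedSum f ⬝ᵥ signedSum f) <
      |∑ i ∈ C, inner ℝ (WithLp.toLp 2 (signedSum f)) (x i ω) ^ 2
          - (#C / n : ℝ) * (signedSum f ⬝ᵥ (S *ᵥ signedSum f))|} with hB₅
  -- The threshold 12 log p is twice 6 log p: each tail is at most 2p⁻⁶, and there are at most 2p²
  -- entries.
  have b₁ : μ.real B₁ ≤ 4 * ((p : ℝ) ^ 4)⁻¹ := by
    refine (measureReal_biUnion_le_card_mul _ (q := 2 * ((p : ℝ) ^ 6)⁻¹) fun ia hia => ?_).trans ?_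
    · have h1 := (h.hasSubgaussianMGF_coord (mem_product.1 hia).1 ia.2).measureReal_sq_gt_le
        (r := 6 * L) (by positivity)
      rw [hexp6] at h1
      refine le_trans (le_of_eq ?_) h1
      congr 1; ext ω; push_cast; simp only [Set.mem_ofPred_eq]; ring_nf
    · rw [card_product, card_univ, Fintype.card_fin]
      push_cast
      calc (#C : ℝ) * p * (2 * ((p : ℝ) ^ 6)⁻¹) ≤ 2 * p * p * (2 * ((p : ℝ) ^ 6)⁻¹) := by gcongr
        _ = _ := by field_simp; norm_num
  have hp1 : ((p : ℝ) ^ 5)⁻¹ ≤ ((p : ℝ) ^ 4)⁻¹ := by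
    gcongr <;> linarith
  have htail : ∀ {Z : ι → Ω → ℝ} {c : ℝ≥0} {v : ℝ}, (c : ℝ) = v / n →
      (∀ i ∈ C, HasSubgaussianMGF (Z i) c μ) →
      μ.real (⋃ i ∈ C, {ω | 12 * L / n * v < Z i ω ^ 2}) ≤ 4 * ((p : ℝ) ^ 4)⁻¹ := by
    intro Z c v hcv hZ
    refine (measureReal_biUnion_le_card_mul _ (q := 2 * ((p : ℝ) ^ 6)⁻¹) fun i hi => ?_).trans ?_
    · have h1 := (hZ i hi).measureReal_sq_gt_le (r := 6 * L) (by positivity)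
      rw [hexp6, hcv] at h1
      refine le_trans (le_of_eq ?_) h1
      congr 1; ext ω; simp only [Set.mem_ofPred_eq]; ring_nf
    · calc (#C : ℝ) * (2 * ((p : ℝ) ^ 6)⁻¹) ≤ 2 * p * (2 * ((p : ℝ) ^ 6)⁻¹) := by gcongr
        _ = 4 * ((p : ℝ) ^ 5)⁻¹ := by field_simp; norm_num
        _ ≤ _ := by gcongr
  have b₂ : μ.real B₂ ≤ 4 * ((p : ℝ) ^ 4)⁻¹ :=
    htail (by push_cast; ring) fun i hi => h.subGaussian_noise i hi
  have b₃ : μ.real B₃ ≤ 4 * ((p : ℝ) ^ 4)⁻¹ :=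
    htail (by push_cast; ring) fun i hi => h.hasSubgaussianMGF_response hi
  have b₄ : μ.real B₄ ≤ 4 * ((p : ℝ) ^ 4)⁻¹ := by
    have hLn : L / n ≤ 1 := (div_le_one hn').2 hlog
    have hr : 112 * √(L / n) ≤ 128 := by
      have := Real.sqrt_le_one.2 hLn
      linarith
    refine (measureReal_biUnion_le_card_mul _ (q := 4 * ((p : ℝ) ^ 6)⁻¹) fun a _ => ?_).trans ?_
    · refine (h.measureReal_abs_sum_coord_mul_noise_gt_le hn hC hσ (by positivity) hr a).trans ?_
      rw [← hexp6, mul_pow, Real.sq_sqrt (by positivity)]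
      gcongr
      -- The constant 112 is chosen so that 112²/2048 exceeds 6, while staying below the admissible
      -- 128.
      have : (n : ℝ) * (112 ^ 2 * (L / n)) / 2048 = 112 ^ 2 / 2048 * L := by field_simp
      rw [this]
      nlinarith
    · rw [card_univ, Fintype.card_fin]
      calc (p : ℝ) * (4 * ((p : ℝ) ^ 6)⁻¹) = 4 * ((p : ℝ) ^ 5)⁻¹ := by field_simp
        _ ≤ _ := by gcongr
  have b₅ : μ.real B₅ ≤ 2 * ((p : ℝ) ^ 4)⁻¹ := by
    refine (measureReal_biUnion_le_card_mul _ (q := 2 * ((p : ℝ) ^ (15 * k))⁻¹)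
      fun f _ => ?_).trans ?_
    · have h1 := h.measureReal_abs_sum_inner_sq_gt_le hn hC hσ hδ0 hδ (WithLp.toLp 2 (signedSum f))
      have h2 : ‖WithLp.toLp 2 (signedSum f)‖ ^ 2 = signedSum f ⬝ᵥ signedSum f := by
        rw [EuclideanSpace.real_norm_sq_eq]
        simp [dotProduct, pow_two]
      rw [h2] at h1
      refine h1.trans ?_
      rw [← hexp]
      gcongr
      push_cast
      exact hδn
    · have hcard : #(univ : Finset (Fin (2 * k) → Fin p × SignType)) = (3 * p) ^ (2 * k) := by
        rw [card_univ, Fintype.card_fun, Fintype.card_prod, Fintype.card_fin, Fintype.card_fin,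
          show Fintype.card SignType = 3 from rfl, mul_comm]
      rw [hcard]
      push_cast
      -- The signs take three values, 0 included, so there are (3p)^(2k) ≤ p^(4k) sums. The exponent
      -- 15k leaves a factor p^(-11k).
      have h1 : (3 * p : ℝ) ^ (2 * k) ≤ (p : ℝ) ^ (4 * k) := by
        rw [show 4 * k = 2 * (2 * k) by ring, pow_mul (p : ℝ) 2]
        gcongr
        nlinarith
      calc (3 * p : ℝ) ^ (2 * k) * (2 * ((p : ℝ) ^ (15 * k))⁻¹)
          ≤ (p : ℝ) ^ (4 * k) * (2 * ((p : ℝ) ^ (15 * k))⁻¹) := by gcongr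
        _ = 2 * ((p : ℝ) ^ (11 * k))⁻¹ := by
          rw [show 15 * k = 4 * k + 11 * k by ring, pow_add]; field_simp
        _ ≤ 2 * ((p : ℝ) ^ 4)⁻¹ := by
          gcongr
          · linarith
          · omega
  have hbad : μ.real (B₁ ∪ B₂ ∪ B₃ ∪ B₄ ∪ B₅) < 1 / (p : ℝ) ^ 2 := by
    have u₁ := measureReal_union_le (μ := μ) (B₁ ∪ B₂ ∪ B₃ ∪ B₄) B₅
    have u₂ := measureReal_union_le (μ := μ) (B₁ ∪ B₂ ∪ B₃) B₄
    have u₃ := measureReal_union_le (μ := μ) (B₁ ∪ B₂) B₃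
    have u₄ := measureReal_union_le (μ := μ) B₁ B₂
    -- The five bounds add up to 4 + 4 + 4 + 4 + 2 = 18 times p⁻⁴, and p ≥ 5 gives p² ≥ 25.
    have h1 : 18 * ((p : ℝ) ^ 4)⁻¹ < 1 / (p : ℝ) ^ 2 := by
      rw [← div_eq_mul_inv, div_lt_div_iff₀ (by positivity) (by positivity)]
      have : 25 ≤ (p : ℝ) ^ 2 := by nlinarith
      nlinarith
    linarith
  obtain ⟨E, hE, hEp, hEB⟩ := exists_measurableSet_disjoint hbad
  refine ⟨E, hE, hEp, fun ω hω => ?_⟩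
  have hω' := hEB ω hω
  simp only [hB₁, hB₂, hB₃, hB₄, hB₅, Set.mem_union, Set.mem_iUnion, Set.mem_ofPred_eq, not_or,
    not_exists, not_lt, mem_product, mem_univ, and_true, Prod.forall, forall_const] at hω'
  obtain ⟨⟨⟨⟨w₁, w₂⟩, w₃⟩, w₄⟩, w₅⟩ := hω'
  exact ⟨fun i hi a => w₁ i a hi, w₂, w₃, w₄, w₅⟩

end Events

/-! ### Restricted eigenvalues and the final assembly. -/

/-- Restricted eigenvalue condition on the cone from concentration on sparse signed sums. -/
lemma restricted_eigenvalue {ι : Type*} {p n k : ℕ} {C : Finset ι}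
    {S : Matrix (Fin p) (Fin p) ℝ} (hS : S.IsHermitian) {x : ι → EuclideanSpace ℝ (Fin p)}
    (hn : 0 < n) (hk : 1 ≤ k) (hC : n ≤ #C) (hlam : 0 ≤ lambdaMin hS)
    (h : ∀ f : Fin (2 * k) → Fin p × SignType,
      |∑ i ∈ C, inner ℝ (WithLp.toLp 2 (signedSum f)) (x i) ^ 2
        - (#C / n : ℝ) * (signedSum f ⬝ᵥ (S *ᵥ signedSum f))|
      ≤ lambdaMin hS / 36 * (signedSum f ⬝ᵥ signedSum f))
    {v : EuclideanSpace ℝ (Fin p)} (hv : l1Norm v ≤ 2 * √(k : ℝ) * ‖v‖) :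
    3 / 4 * lambdaMin hS * ‖v‖ ^ 2 ≤ ∑ i ∈ C, inner ℝ (x i) v ^ 2 := by
  have hn' : (0 : ℝ) < n := by exact_mod_cast hn
  set M := gram C x - (#C / n : ℝ) • S with hM
  have hMapp : ∀ u : EuclideanSpace ℝ (Fin p), (u : Fin p → ℝ) ⬝ᵥ (M *ᵥ (u : Fin p → ℝ))
      = ∑ i ∈ C, inner ℝ (x i) u ^ 2
        - (#C / n : ℝ) * ((u : Fin p → ℝ) ⬝ᵥ (S *ᵥ (u : Fin p → ℝ))) := by
    intro u
    rw [hM, Matrix.sub_mulVec, dotProduct_sub, dotProduct_gram_mulVec, Matrix.smul_mulVec,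
      dotProduct_smul, smul_eq_mul]
    simp only [pow_two]
  obtain ⟨m, rfl⟩ : ∃ m, k = m + 1 := ⟨k - 1, by omega⟩
  -- Maurey's bound with 2k atoms divides by 2k - 1 ≥ k, so on the cone the loss is at most δ + 8δ =
  -- 9δ times ‖v‖². For δ = λ/36 this is λ/4.
  have hmm : 2 * (m + 1) = (2 * m + 1) + 1 := by ring
  rw [hmm] at h
  have h1 := Matrix.le_dotProduct_mulVec_of_signedSum (m := 2 * m + 1) (by omega) M
    (δ := lambdaMin hS / 36) (by positivity) (fun f => by
      have := hMapp (WithLp.toLp 2 (signedSum f))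
      simp only at this
      rw [this]
      simpa only [real_inner_comm] using h f) v
  rw [hMapp] at h1
  have h2 : (v : Fin p → ℝ) ⬝ᵥ (v : Fin p → ℝ) = ‖v‖ ^ 2 := by
    rw [EuclideanSpace.real_norm_sq_eq]
    simp [dotProduct, pow_two]
  have h3 : (∑ j, |v j|) ^ 2 ≤ 4 * (m + 1) * ‖v‖ ^ 2 := by
    calc (∑ j, |v j|) ^ 2 ≤ (2 * √((m + 1 : ℕ) : ℝ) * ‖v‖) ^ 2 := by
          gcongr
          exact hv
      _ = _ := by rw [mul_pow, mul_pow, Real.sq_sqrt (by positivity)]; push_cast; ring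
  have h4 : 2 * (lambdaMin hS / 36) * (∑ j, |v j|) ^ 2 / (2 * m + 1 : ℕ)
      ≤ 2 * (lambdaMin hS / 36) * (4 * ‖v‖ ^ 2) := by
    rw [div_le_iff₀ (by positivity), mul_assoc (2 * (lambdaMin hS / 36))]
    gcongr
    refine h3.trans ?_
    push_cast
    have : 0 ≤ m * ‖v‖ ^ 2 := by positivity
    linarith
  have h5 := lambdaMin_mul_norm_sq_le hS v
  have h6 : (1 : ℝ) ≤ #C / n := by
    rw [one_le_div hn']; exact_mod_cast hC
  have h7 : 0 ≤ lambdaMin hS * ‖v‖ ^ 2 := by positivity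
  have h8 : lambdaMin hS * ‖v‖ ^ 2
      ≤ (#C / n : ℝ) * ((v : Fin p → ℝ) ⬝ᵥ (S *ᵥ (v : Fin p → ℝ))) :=
    h5.trans (le_mul_of_one_le_left (h7.trans h5) h6)
  rw [h2] at h1
  linarith

theorem corollary1 :
    ∃ C₁ c₂ C₃ : ℝ, 0 < C₁ ∧ 0 < c₂ ∧ 0 < C₃ ∧
      ∀ (Ω : Type*) [MeasurableSpace Ω] (μ : Measure Ω) [IsProbabilityMeasure μ]
        (p n nO k : ℕ) (C : Finset (Fin (n + nO)))
        (S : Matrix (Fin p) (Fin p) ℝ) (hS : S.PosDef) (σx σε : ℝ≥0)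
        (β : EuclideanSpace ℝ (Fin p))
        (x : Fin (n + nO) → Ω → EuclideanSpace ℝ (Fin p)) (ε y : Fin (n + nO) → Ω → ℝ),
        1 ≤ n → n ≤ p → 1 ≤ k → k < p → IsSparse k β → n ≤ #C →
        SubGaussianLinearModel μ n C S σx σε β x ε y →
        C₁ * ((σx : ℝ) ^ 4 / lambdaMin hS.isHermitian ^ 2 * k * Real.log p) ≤ n →
        (nO : ℝ) / n ≤ c₂ * (lambdaMin hS.isHermitian / ((σx : ℝ) ^ 2 * k * Real.log p)) →
        ∃ E : Set Ω, MeasurableSet E ∧ 1 - 1 / (p : ℝ) ^ 2 < μ.real E ∧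
          ∀ ω ∈ E, ∀ (X : Matrix (Fin (n + nO)) (Fin p) ℝ) (Y : Fin (n + nO) → ℝ)
            (b : EuclideanSpace ℝ (Fin p)),
            IsCorruption n C (fun i => x i ω) (fun i => y i ω) X Y →
            IsRENOutput 1 (l1Norm β) n X Y b →
            1 / (2 * √(k : ℝ)) * l1Norm (b - β) ≤ ‖b - β‖ ∧
            ‖b - β‖ ≤ C₃ * (32 / lambdaMin hS.isHermitian *
              (k * nO * Real.log p / n * (σx : ℝ) ^ 2 * ‖β‖
                + √(k * (σx : ℝ) ^ 2 * (σε : ℝ) ^ 2 * Real.log p / n)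
                + nO * Real.log p * √(k : ℝ) * σx / n
                  * √((σε : ℝ) ^ 2 + (σx : ℝ) ^ 2 * ‖β‖ ^ 2))) := by
  -- The first constant exceeds 15 · 2048 · 36², the requirement of the good event with δ = λ/36.
  -- The second makes the outlier loss 144 k nO σx² log p / n at most λ/4, so curvature λ/2
  -- survives. The third is 2 · 4 · 112 / 32.
  refine ⟨40000000, 1 / 576, 28, by norm_num, by norm_num, by norm_num, ?_⟩
  intro Ω _ μ _ p n nO k C S hS σx σε β x ε y hn hnp hk hkp hβ hC h hsample hout
  have hp2 : 2 ≤ p := by omega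
  have : NeZero p := ⟨by omega⟩
  have hlam0 := lambdaMin_pos hS
  have hlamσ := h.lambdaMin_le hS.isHermitian (by omega) (by omega) (card_pos.1 (by omega))
  set lam := lambdaMin hS.isHermitian with hlam
  set L := Real.log p with hL
  have hL0 : 0.69 < L := by
    have h1 : Real.log 2 ≤ L := Real.log_le_log (by norm_num) (by exact_mod_cast hp2)
    have := Real.log_two_gt_d9
    linarith
  have hn' : (0 : ℝ) < n := by exact_mod_cast hn
  have hk' : (1 : ℝ) ≤ k := by exact_mod_cast hk
  have hσ : σx ≠ 0 := by
    rintro rfl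
    simp at hlamσ
    linarith
  have hσ' : (0 : ℝ) < σx := by positivity
  have hkL : L ≤ k * L := le_mul_of_one_le_left (by linarith) hk'
  have hsample' : 40000000 * ((σx : ℝ) ^ 4 * (k * L)) ≤ n * lam ^ 2 := by
    have h1 := mul_le_mul_of_nonneg_right hsample (sq_nonneg lam)
    calc _ = 40000000 * ((σx : ℝ) ^ 4 / lam ^ 2 * k * L) * lam ^ 2 := by field_simp
      _ ≤ _ := h1
  have hnL : 2500000 * (k * L) ≤ n := by
    have h1 : lam ^ 2 ≤ 16 * (σx : ℝ) ^ 4 := by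
      calc lam ^ 2 ≤ (4 * (σx : ℝ) ^ 2) ^ 2 := by gcongr
        _ = _ := by ring
    have h2 : (n : ℝ) * lam ^ 2 ≤ n * (16 * (σx : ℝ) ^ 4) := by gcongr
    have h3 : (0 : ℝ) < 16 * (σx : ℝ) ^ 4 := by positivity
    refine le_of_mul_le_mul_right ?_ h3
    linarith
  have hp5 : 5 ≤ p := by
    have h1 : (5 : ℝ) ≤ n := by linarith
    have h2 : 5 ≤ n := by exact_mod_cast h1
    omega
  have hout' : 576 * (k * nO * (σx : ℝ) ^ 2 * L / n) ≤ lam := by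
    have h0 : (0 : ℝ) < (σx : ℝ) ^ 2 * k * L := by positivity
    have h1 := mul_le_mul_of_nonneg_right hout h0.le
    have h2 : 1 / 576 * (lam / ((σx : ℝ) ^ 2 * k * L)) * ((σx : ℝ) ^ 2 * k * L) = lam / 576 := by
      field_simp
    rw [h2] at h1
    have h3 : (k * nO * (σx : ℝ) ^ 2 * L / n) = nO / n * ((σx : ℝ) ^ 2 * k * L) := by ring
    rw [h3]
    linarith
  -- This yields at most 2n clean samples, as the concentration bounds require.
  have hnO : nO ≤ n := by
    have h1 : 576 * (nO / n * (k * L)) ≤ (4 : ℝ) := by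
      have h2 : (0 : ℝ) < (σx : ℝ) ^ 2 := by positivity
      refine le_of_mul_le_mul_right ?_ h2
      calc 576 * (nO / n * (k * L)) * (σx : ℝ) ^ 2 = 576 * (k * nO * (σx : ℝ) ^ 2 * L / n) := by
            ring
        _ ≤ _ := hout'.trans hlamσ
    have h2 : (nO / n : ℝ) * 0.69 ≤ nO / n * (k * L) := by gcongr; linarith
    have h3 : (nO / n : ℝ) ≤ 1 := by linarith
    rw [div_le_one hn'] at h3
    exact_mod_cast h3
  have hC2 : #C ≤ 2 * n := by
    have h1 := card_le_univ C
    rw [Fintype.card_fin] at h1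
    omega
  obtain ⟨E, hE, hEp, hgood⟩ := h.exists_good_event (by omega) hnp hC2 hσ hp5 hk (by linarith)
    (δ := lam / 36) (by positivity) (by linarith [sq_nonneg (σx : ℝ)]) (by
      rw [le_div_iff₀ (by positivity)]
      have : (0 : ℝ) ≤ (σx : ℝ) ^ 4 * (k * L) := by positivity
      linarith)
  refine ⟨E, hE, hEp, fun ω hω X Y b hcor hb => ?_⟩
  obtain ⟨hx, hε, hy, hτ, hsigned⟩ := hgood ω hω
  have hcone : l1Norm (b - β) ≤ 2 * √(k : ℝ) * ‖b - β‖ := by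
    obtain ⟨Γ, γ, -, hbR, -⟩ := hb
    exact hβ.l1Norm_sub_le hbR
  refine ⟨by rw [one_div_mul_eq_div, div_le_iff₀ (by positivity)]; linarith, ?_⟩
  have hRE := restricted_eigenvalue hS.isHermitian (by omega) hk hC hlam0.le hsigned hcone
  rw [← hlam] at hRE
  set s := √(12 * L / n) with hs
  have hs2 : s ^ 2 = 12 * L / n := Real.sq_sqrt (by positivity)
  have habs : ∀ {z q : ℝ}, 0 ≤ q → z ^ 2 ≤ 12 * L / n * q ^ 2 → |z| ≤ s * q := by
    intro z q hq hz
    rw [← hs2, ← mul_pow] at hz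
    exact abs_le_of_sq_le_sq hz (by positivity)
  set ρ := √((σε : ℝ) ^ 2 + (σx : ℝ) ^ 2 * ‖β‖ ^ 2) with hρ
  have hρ2 : ρ ^ 2 = (σε : ℝ) ^ 2 + (σx : ℝ) ^ 2 * ‖β‖ ^ 2 := Real.sq_sqrt (by positivity)
  have hρε : (σε : ℝ) ≤ ρ := Real.le_sqrt_of_sq_le (by
    have : 0 ≤ (σx : ℝ) ^ 2 * ‖β‖ ^ 2 := by positivity
    linarith)
  have hmain := IsRENOutput.error_bound (Bx := s * σx) (Bε := s * σε) (By := s * ρ)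
    (τ := σx * σε * (112 * √(L / n))) (Fintype.card_fin _) hβ (by positivity) (by positivity)
    (by positivity) (by positivity)
    (fun i hi a => habs (by positivity) (hx i hi a)) (fun i hi => habs (by positivity) (hε i hi))
    (fun i hi => habs (by positivity) (by rw [hρ2]; exact hy i hi))
    (fun i hi => h.linear_model i hi ω) hτ hRE hcor hb
  have hcoef : lam / 2 ≤ 3 / 4 * lam - 12 * k * nO * (s * σx) ^ 2 := by
    have : 12 * k * nO * (s * σx) ^ 2 = 144 * (k * nO * (σx : ℝ) ^ 2 * L / n) := by
      rw [mul_pow, hs2]; ring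
    linarith
  set T₁ := k * nO * L / n * (σx : ℝ) ^ 2 * ‖β‖ with hT₁
  set T₂ := √(k * (σx : ℝ) ^ 2 * (σε : ℝ) ^ 2 * L / n) with hT₂
  set T₃ := nO * L * √(k : ℝ) * σx / n * ρ with hT₃
  have hsk : √(k : ℝ) ^ 2 = k := Real.sq_sqrt (by positivity)
  have e₁ : √(k : ℝ) * (2 * nO * (s * σx) ^ 2 * (√(k : ℝ) * ‖β‖)) = 24 * T₁ := by
    calc _ = 2 * nO * s ^ 2 * (σx : ℝ) ^ 2 * ‖β‖ * √(k : ℝ) ^ 2 := by ring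
      _ = _ := by rw [hsk, hs2, hT₁]; ring
  have e₂ : √(k : ℝ) * (σx * σε * (112 * √(L / n))) = 112 * T₂ := by
    have : T₂ = √(k : ℝ) * (σx * σε * √(L / n)) := by
      rw [hT₂, Real.sqrt_eq_iff_mul_self_eq (by positivity) (by positivity)]
      have h1 : √(L / n) ^ 2 = L / n := Real.sq_sqrt (by positivity)
      symm
      calc √(k : ℝ) * (σx * σε * √(L / n)) * (√(k : ℝ) * (σx * σε * √(L / n)))
          = √(k : ℝ) ^ 2 * (σx : ℝ) ^ 2 * (σε : ℝ) ^ 2 * √(L / n) ^ 2 := by ring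
        _ = _ := by rw [hsk, h1]; ring
    rw [this]; ring
  have e₃ : √(k : ℝ) * (nO * (s * σx) * (s * ρ)) = 12 * T₃ := by
    calc _ = √(k : ℝ) * nO * s ^ 2 * σx * ρ := by ring
      _ = _ := by rw [hs2, hT₃]; ring
  have e₄ : √(k : ℝ) * (nO * (s * σx) * (s * σε)) ≤ 12 * T₃ := by
    rw [← e₃]; gcongr
  have hT₁0 : 0 ≤ T₁ := by positivity
  have hT₂0 : 0 ≤ T₂ := by positivity
  have hT₃0 : 0 ≤ T₃ := by positivity
  -- The coefficients of T₁, T₂, T₃ inside the bracket are at most 48, 112 and 36, all covered by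
  -- 112.
  have h1 : lam / 2 * ‖b - β‖ ≤ 4 * (112 * (T₁ + T₂ + T₃)) := by
    refine (mul_le_mul_of_nonneg_right hcoef (norm_nonneg _)).trans (hmain.trans ?_)
    linarith
  calc ‖b - β‖ = 2 / lam * (lam / 2 * ‖b - β‖) := by field_simp
    _ ≤ 2 / lam * (4 * (112 * (T₁ + T₂ + T₃))) := by gcongr
    _ = _ := by ring
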